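/- Let $N\ge 2$ and $m$ be integers, let $E,F$ be finite-dimensional complex vector spaces (with any norms), and let $A(D)=\sum_{|\alpha|=m}a_\alpha\partial^\alpha$, with $a_\alpha\in\mathcal L(E,F)$, be a homogeneous linear differential operator of order $m$ on $\mathbb R^N$ from $E$ to $F$ with constant complex coefficients and symbol $A(\xi)=\sum_{|\alpha|=m}\xi^\alpha a_\alpha$. Assume that $A(D)$ is elliptic, i.e. $A(\xi):E\to F$ is injective for every $\xi\in\mathbb R^N\setminus\{0\}$, and canceling, i.e. $\bigcap_{\xi\in\mathbb R^N\setminus\{0\}}A(\xi)[E]=\{0\}$. Let $1\le q<\infty$ and let $\ell$ be a real number with $0<\ell<N$ and $\ell\le m$. Let $\nu$ be a $\sigma$-finite non-negative Borel measure on $\mathbb R^N$, and let $w:\mathbb R^N\to\mathbb R$ be a weight, i.e. $w$ is locally integrable and $w>0$ almost everywhere. Suppose that there are constants $C_3,C_4$ such that, for almost every $y\in\mathbb R^N$, $$\left(\int_{\{|x|\ge 2|y|\}}\frac{d\nu(x)}{|x|^{(N-\ell+1)q}}\right)^{1/q}\le C_3\,\frac{w(y)}{|y|}\qquad\text{and}\qquad\left(\int_{\{|x|<4|y|\}}\frac{d\nu(x)}{|x-y|^{(N-\ell)q}}\right)^{1/q}\le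 C_4\,w(y).$$ Then there exists a constant $C>0$ such that $$\left(\int_{\mathbb R^N}\bigl|(-\Delta)^{(m-\ell)/2}u(x)\bigr|^q\,d\nu(x)\right)^{1/q}\le C\int_{\mathbb R^N}|A(D)u(x)|\,w(x)\,dx\qquad\text{for all }u\in C_c^\infty(\mathbb R^N,E),$$ where $(-\Delta)^{(m-\ell)/2}u$ is the continuous function $x\mapsto\int_{\mathbb R^N}(2\pi|\xi|)^{m-\ell}\,\widehat u(\xi)\,e^{2\pi i x\cdot\xi}\,d\xi$, with $\widehat u(\xi)=\int_{\mathbb R^N}u(x)\,e^{-2\pi i x\cdot\xi}\,dx$. -/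

import Mathlib

open MeasureTheory
open scoped ENNReal NNReal FourierTransform

noncomputable section

namespace WeightedHLS

/-- The space `ℝ^N` with its Euclidean norm. -/
abbrev RN (N : ℕ) : Type := EuclideanSpace ℝ (Fin N)

/-- The multi-indices `α ∈ ℕ^N` of length `|α| = m`. -/
def multiIndices (N m : ℕ) : Finset (Fin N → ℕ) := Finset.piAntidiag Finset.univ m

theorem mem_multiIndices {N m : ℕ} {α : Fin N → ℕ} :
    α ∈ multiIndices N m ↔ ∑ i, α i = m := by
  simp [multiIndices]

section Operators

variable {N : ℕ} {E F : Type*}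
  [NormedAddCommGroup E] [NormedSpace ℂ E] [NormedAddCommGroup F] [NormedSpace ℂ F]

/-- The partial derivative `∂_i f`. -/
def partialDeriv (i : Fin N) (f : RN N → E) (x : RN N) : E :=
  fderiv ℝ f x (EuclideanSpace.single i (1 : ℝ))

/-- The iterated partial derivative `∂^α f = ∂_1^{α_1} ⋯ ∂_N^{α_N} f`. -/
def multiDeriv (α : Fin N → ℕ) (f : RN N → E) : RN N → E :=
  (List.finRange N).foldr (fun i g => (partialDeriv i)^[α i] g) f

/-- A homogeneous linear differential operator `A(D) = ∑_{|α| = m} a_α ∂^α` of order `m` on `ℝ^N`,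
from `E` to `F`, with constant complex coefficients: it is the family of its coefficients. -/
structure HomDiffOp (N m : ℕ) (E F : Type*)
    [NormedAddCommGroup E] [NormedSpace ℂ E] [NormedAddCommGroup F] [NormedSpace ℂ F] where
  /-- The coefficients `a_α ∈ L(E, F)`, one for each multi-index of length `m`. -/
  coeff : multiIndices N m → (E →ₗ[ℂ] F)

namespace HomDiffOp

variable {m : ℕ} (A : HomDiffOp N m E F)

/-- The function `A(D)u = ∑_{|α| = m} a_α ∂^α u`. -/
def apply (u : RN N → E) (x : RN N) : F :=
  ∑ α : multiIndices N m, A.coeff α (multiDeriv α.1 u x)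

/-- The symbol `A(ξ) = ∑_{|α| = m} ξ^α a_α : E → F` at `ξ ∈ ℝ^N`. -/
def symbol (ξ : RN N) : E →ₗ[ℂ] F :=
  ∑ α : multiIndices N m, ((∏ i, ξ i ^ α.1 i : ℝ) : ℂ) • A.coeff α

/-- `A(D)` is elliptic: `A(ξ)` is injective for every `ξ ∈ ℝ^N \ {0}`. -/
def IsElliptic : Prop :=
  ∀ ξ : RN N, ξ ≠ 0 → Function.Injective (A.symbol ξ)

/-- `A(D)` is canceling: the intersection of `A(ξ)[E]` over `ξ ∈ ℝ^N \ {0}` is `{0}`. -/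
def IsCanceling : Prop :=
  ⋂ ξ ∈ {ξ : RN N | ξ ≠ 0}, Set.range (A.symbol ξ) = {0}

end HomDiffOp

/-- The fractional Laplacian `(-Δ)^{s/2} u` (so `s` is its order), the Fourier multiplier with
symbol `(2π|ξ|)^s`, for the Fourier transform `û(ξ) = ∫ u(x) e^{-2πi x·ξ} dx`.
For `s ≥ 0` and `u` smooth with compact support, `(2π|ξ|)^s û(ξ)` is continuous and integrable, and
the value at every point `x` is the convergent inverse Fourier integral. -/
def fracLaplacian (s : ℝ) (u : RN N → E) : RN N → E :=
  𝓕⁻ (fun ξ : RN N => (((2 * Real.pi * ‖ξ‖) ^ s : ℝ) : ℂ) • 𝓕 u ξ)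

/-- The weighted norm `‖g‖_{L^1_w} = ∫ |g(x)| w(x) dx`, with values in `[0, ∞]`. -/
def weightedL1Norm (w : RN N → ℝ) (g : RN N → F) : ℝ≥0∞ :=
  ∫⁻ x, ‖g x‖ₑ * ENNReal.ofReal (w x)

end Operators

section Weights

variable {N : ℕ}

/-- A weight on `ℝ^N`: a locally integrable function that is positive almost everywhere. -/
structure IsWeight (w : RN N → ℝ) : Prop where
  locallyIntegrable : LocallyIntegrable w
  ae_pos : ∀ᵐ x, 0 < w x

/-- The testing condition away from the origin: for some constant `C`, for a.e. `y`,
`(∫_{|x| ≥ 2|y|} |x|^{-(N-ℓ+1)q} dν(x))^{1/q} ≤ C w(y) / |y|`. -/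
def TestingFar (ℓ q : ℝ) (ν : Measure (RN N)) (w : RN N → ℝ) : Prop :=
  ∃ C : ℝ≥0, ∀ᵐ y : RN N,
    (∫⁻ x in (Metric.ball (0 : RN N) (2 * ‖y‖))ᶜ, ‖x‖ₑ ^ (-(((N : ℝ) - ℓ + 1) * q)) ∂ν) ^ (1 / q)
      ≤ C * ENNReal.ofReal (w y / ‖y‖)

/-- The testing condition near the origin: for some constant `C`, for a.e. `y`,
`(∫_{|x| < 4|y|} |x - y|^{-(N-ℓ)q} dν(x))^{1/q} ≤ C w(y)`. The integrand is `∞` at `x = y`. -/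
def TestingNear (ℓ q : ℝ) (ν : Measure (RN N)) (w : RN N → ℝ) : Prop :=
  ∃ C : ℝ≥0, ∀ᵐ y : RN N,
    (∫⁻ x in Metric.ball (0 : RN N) (4 * ‖y‖), ‖x - y‖ₑ ^ (-(((N : ℝ) - ℓ) * q)) ∂ν) ^ (1 / q)
      ≤ C * ENNReal.ofReal (w y)

end Weights

end WeightedHLS

end

/-! Ellipticity gives a smooth left inverse `B` of the symbol, homogeneous of degree `-m`, so the
fractional Laplacian of `u` is a Fourier multiplier of degree `-ℓ` applied to `g = A(D)u`. Slicing
this multiplier by `∫ χ(tξ) dt/t = 1`, with `χ` radial and supported in an annulus, turns it into an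
integral over `t > 0` of `t^{-a-1} ∫ k(t⁻¹(x - y)) g(y) dy`, where `a = N - ℓ` and `k` is Schwartz.

Integrating in `t` directly yields only the kernel bound `|x - y|^{-a}`, which decays too slowly for
`|x| ≥ 2|y|`. Cancellation supplies the missing power. It provides a smooth compactly supported `Ψ`
with `Ψ(ξ) A(ξ) = 0` and `∫ Ψ = id`. Its transform `Φ` is Schwartz, `Φ(0) = id`, and `∫ Φ(y/r) g(y)
dy = 0` for every `r > 0`. Hence `k(t⁻¹x) Φ(y/|x|)` may be subtracted from the kernel without
changing the integral. For `|x| ≥ 2|y|` the difference gains a factor `|y|/|x|`; for `|x| < 2|y|`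
both terms are controlled by `|x - y|^{-a}` after integration in `t`.

The two resulting kernels are those of the testing conditions, and Minkowski's integral inequality
in `L^q(ν)` concludes. The main steps are `exists_annihilator_integral_eq_id`,
`exists_lintegral_correctedKernel_le`, `exists_fracLaplacian_enorm_le` and
`weighted_estimate_of_pointwise`. -/

namespace WeightedHLS

open Filter Topology
open scoped ContDiff

/-! ### Minkowski's integral inequality -/

section Minkowski

variable {X Y : Type*} [MeasurableSpace X] [MeasurableSpace Y]

/-- Duality argument: write `h^q = h^{q-1} h`, exchange the integrals, apply Hölder in `x`, and
divide by `I^{1/p}`. The division needs `I` finite, so `h` is only required to lie below the inner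
integral, which admits truncations. -/
theorem lintegral_rpow_le_of_le_lintegral {μ : Measure X} {ν : Measure Y} [SFinite μ] [SFinite ν]
    {p q : ℝ} (hpq : q.HolderConjugate p) {f : X → Y → ℝ≥0∞}
    (hf : Measurable (Function.uncurry f)) {h : X → ℝ≥0∞} (hm : Measurable h)
    (hle : ∀ x, h x ≤ ∫⁻ y, f x y ∂ν) (hfin : ∫⁻ x, h x ^ q ∂μ ≠ ⊤) :
    (∫⁻ x, h x ^ q ∂μ) ^ (1 / q) ≤ ∫⁻ y, (∫⁻ x, f x y ^ q ∂μ) ^ (1 / q) ∂ν := by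
  set I := ∫⁻ x, h x ^ q ∂μ with hI
  have hq0 : 0 < q := hpq.pos
  have hp0 : 0 < p := hpq.symm.pos
  by_cases hI0 : I = 0
  · rw [hI0, ENNReal.zero_rpow_of_pos (by positivity)]; exact zero_le
  have hpow : ∀ x, (h x ^ (q - 1)) ^ p = h x ^ q := fun x => by
    rw [← ENNReal.rpow_mul, hpq.sub_one_mul_conj]
  have key : I ≤ I ^ (1 / p) * ∫⁻ y, (∫⁻ x, f x y ^ q ∂μ) ^ (1 / q) ∂ν := by
    calc I = ∫⁻ x, h x ^ (q - 1) * h x ∂μ := by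
          refine lintegral_congr fun x => ?_
          conv_rhs => rw [← ENNReal.rpow_one (h x), ← ENNReal.rpow_mul, one_mul]
          rw [← ENNReal.rpow_add_of_nonneg _ _ hpq.sub_one_pos.le zero_le_one]
          simp
      _ ≤ ∫⁻ x, ∫⁻ y, h x ^ (q - 1) * f x y ∂ν ∂μ := by
          refine lintegral_mono fun x => ?_
          rw [lintegral_const_mul (f := fun y => f x y) _ (hf.comp measurable_prodMk_left)]
          gcongr
          exact hle x
      _ = ∫⁻ y, ∫⁻ x, h x ^ (q - 1) * f x y ∂μ ∂ν := by
          refine lintegral_lintegral_swap (Measurable.aemeasurable ?_)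
          exact ((hm.comp measurable_fst).pow_const _).mul hf
      _ ≤ ∫⁻ y, I ^ (1 / p) * (∫⁻ x, f x y ^ q ∂μ) ^ (1 / q) ∂ν := by
          refine lintegral_mono fun y => ?_
          have := ENNReal.lintegral_mul_le_Lp_mul_Lq μ hpq.symm
            (f := fun x => h x ^ (q - 1)) (g := fun x => f x y)
            (hm.pow_const _).aemeasurable (hf.comp measurable_prodMk_right).aemeasurable
          simpa only [hpow, Pi.mul_apply] using this
      _ = _ := lintegral_const_mul' _ _ (ENNReal.rpow_ne_top_of_nonneg (by positivity) hfin)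
  have hsplit : I = I ^ (1 / p) * I ^ (1 / q) := by
    rw [← ENNReal.rpow_add_of_nonneg _ _ (by positivity) (by positivity)]
    rw [one_div, one_div, hpq.symm.inv_add_inv_eq_one, ENNReal.rpow_one]
  replace key := hsplit.symm.trans_le key
  refine (ENNReal.mul_le_mul_iff_right ?_ ?_).1 key
  · rw [Ne, ENNReal.rpow_eq_zero_iff]
    rintro (⟨h, -⟩ | ⟨h, -⟩)
    · exact hI0 h
    · exact hfin h
  · exact ENNReal.rpow_ne_top_of_nonneg (by positivity) hfin

/-- Minkowski's integral inequality. -/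
theorem lintegral_rpow_lintegral_le {μ : Measure X} {ν : Measure Y} [SigmaFinite μ] [SFinite ν]
    {q : ℝ} (hq : 1 ≤ q) {f : X → Y → ℝ≥0∞} (hf : Measurable (Function.uncurry f)) :
    (∫⁻ x, (∫⁻ y, f x y ∂ν) ^ q ∂μ) ^ (1 / q)
      ≤ ∫⁻ y, (∫⁻ x, f x y ^ q ∂μ) ^ (1 / q) ∂ν := by
  rcases hq.eq_or_lt with rfl | hq1
  · simpa using (lintegral_lintegral_swap hf.aemeasurable).le
  have hpq := Real.HolderConjugate.conjExponent hq1
  have hq0 : 0 < q := hpq.pos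
  set H : X → ℝ≥0∞ := fun x => ∫⁻ y, f x y ∂ν with hH
  have hHm : Measurable H := hf.lintegral_prod_right'
  -- Truncating in height and to sets of finite measure makes the `q`-th moments finite; monotone
  -- convergence removes the truncation.
  let h : ℕ → X → ℝ≥0∞ := fun n => (spanningSets μ n).indicator fun x => min (H x) n
  have hm : ∀ n, Measurable (h n) := fun n =>
    (hHm.min measurable_const).indicator (measurableSet_spanningSets μ n)
  have hle : ∀ n x, h n x ≤ H x := fun n x =>
    (Set.indicator_le_self _ _ x).trans (min_le_left _ _)
  have hfin : ∀ n, ∫⁻ x, h n x ^ q ∂μ ≠ ⊤ := fun n => by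
    refine ne_top_of_le_ne_top (b := (n : ℝ≥0∞) ^ q * μ (spanningSets μ n)) ?_ ?_
    · exact ENNReal.mul_ne_top (ENNReal.rpow_ne_top_of_nonneg hq0.le (ENNReal.natCast_ne_top n))
        (measure_spanningSets_lt_top μ n).ne
    · rw [← lintegral_indicator_const (measurableSet_spanningSets μ n)]
      refine lintegral_mono fun x => ?_
      by_cases hx : x ∈ spanningSets μ n
      · simp only [h, Set.indicator_of_mem hx]
        gcongr
        exact min_le_right _ _
      · simp [h, Set.indicator_of_notMem hx, ENNReal.zero_rpow_of_pos hq0]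
  have hlim : Tendsto (fun n => ∫⁻ x, h n x ^ q ∂μ) atTop (𝓝 (∫⁻ x, H x ^ q ∂μ)) := by
    refine lintegral_tendsto_of_tendsto_of_monotone
      (fun n => ((hm n).pow_const _).aemeasurable) (ae_of_all _ fun x n k hnk => ?_)
      (ae_of_all _ fun x => ?_)
    · refine ENNReal.rpow_le_rpow ?_ hq0.le
      by_cases hx : x ∈ spanningSets μ n
      · simp only [h, Set.indicator_of_mem hx,
          Set.indicator_of_mem (monotone_spanningSets μ hnk hx)]
        gcongr
      · simp [h, Set.indicator_of_notMem hx]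
    · have h1 : Tendsto (fun n : ℕ => min (H x) (n : ℝ≥0∞)) atTop (𝓝 (H x)) := by
        simpa using (tendsto_const_nhds (x := H x)).min ENNReal.tendsto_nat_nhds_top
      refine ((ENNReal.continuous_rpow_const (y := q)).tendsto _).comp (h1.congr' ?_)
      filter_upwards [eventually_ge_atTop (spanningSetsIndex μ x)] with n hn
      have : x ∈ spanningSets μ n := monotone_spanningSets μ hn (mem_spanningSetsIndex μ x)
      simp [h, Set.indicator_of_mem this]
  have h2 := le_of_tendsto' (((ENNReal.continuous_rpow_const (y := 1 / q)).tendsto _).comp hlim)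
    fun n => lintegral_rpow_le_of_le_lintegral (ν := ν) hpq hf (hm n) (hle n) (hfin n)
  exact h2

end Minkowski

/-! ### Decay of rescaled Schwartz functions -/

section Kernel

/-- The profile `t^{-a-1} min(1, (t/r)^p)` which dominates a rescaled Schwartz function. -/
noncomputable def scaleProfile (a : ℝ) (p : ℕ) (r t : ℝ) : ℝ := t ^ (-a - 1) * min 1 ((t / r) ^ p)

theorem measurable_scaleProfile (a : ℝ) (p : ℕ) (r : ℝ) : Measurable (scaleProfile a p r) := by
  unfold scaleProfile
  fun_prop

theorem scaleProfile_nonneg (a : ℝ) (p : ℕ) {r t : ℝ} (hr : 0 < r) (ht : 0 < t) :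
    0 ≤ scaleProfile a p r t := by
  unfold scaleProfile; positivity

/-- Split at `t = r`: the factor `(t/r)^p` with `p > a` gives convergence at `0`, and `t^{-a-1}`
with `a > 0` gives it at infinity. -/
theorem lintegral_scaleProfile_le {a : ℝ} (ha : 0 < a) {p : ℕ} (hp : a < p) {r : ℝ} (hr : 0 < r) :
    ∫⁻ t in Set.Ioi 0, ENNReal.ofReal (scaleProfile a p r t)
      ≤ ENNReal.ofReal ((1 / (p - a) + 1 / a) * r ^ (-a)) := by
  have hpa : 0 < (p : ℝ) - a := by linarith
  have h1 : ∫⁻ t in Set.Ioc 0 r, ENNReal.ofReal (scaleProfile a p r t)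
      ≤ ENNReal.ofReal (1 / (p - a) * r ^ (-a)) := by
    have hint : IntegrableOn (fun t : ℝ => r ^ (-(p : ℝ)) * t ^ ((p : ℝ) - a - 1)) (Set.Ioc 0 r) := by
      refine Integrable.const_mul ?_ _
      exact (intervalIntegrable_iff_integrableOn_Ioc_of_le hr.le).1
        (intervalIntegral.intervalIntegrable_rpow' (by linarith))
    have hval : ∫ t in Set.Ioc 0 r, r ^ (-(p : ℝ)) * t ^ ((p : ℝ) - a - 1)
        = 1 / (p - a) * r ^ (-a) := by
      rw [← intervalIntegral.integral_of_le hr.le, intervalIntegral.integral_const_mul,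
        integral_rpow (Or.inl (by linarith)), sub_add_cancel, Real.zero_rpow hpa.ne', sub_zero,
        mul_div_assoc', ← Real.rpow_add hr]
      rw [show -(p : ℝ) + (p - a) = -a by ring]
      ring
    rw [← hval, ofReal_integral_eq_lintegral_ofReal hint
      ((ae_restrict_mem measurableSet_Ioc).mono fun t ht => by
        have := ht.1
        positivity)]
    refine setLIntegral_mono' measurableSet_Ioc fun t ht => ENNReal.ofReal_le_ofReal ?_
    have ht0 : 0 < t := ht.1
    calc scaleProfile a p r t ≤ t ^ (-a - 1) * (t / r) ^ p := by
          unfold scaleProfile; gcongr; exact min_le_right _ _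
      _ = r ^ (-(p : ℝ)) * t ^ ((p : ℝ) - a - 1) := by
          rw [div_pow, Real.rpow_neg hr.le, Real.rpow_natCast,
            show (p : ℝ) - a - 1 = (-a - 1) + p by ring, Real.rpow_add ht0, Real.rpow_natCast]
          ring
  have h2 : ∫⁻ t in Set.Ioi r, ENNReal.ofReal (scaleProfile a p r t)
      ≤ ENNReal.ofReal (1 / a * r ^ (-a)) := by
    have hlt : -a - 1 < -1 := by linarith
    have hval : ∫ t in Set.Ioi r, t ^ (-a - 1) = 1 / a * r ^ (-a) := by
      rw [integral_Ioi_rpow_of_lt hlt hr]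
      rw [show -a - 1 + 1 = -a by ring]
      field_simp
    rw [← hval, ofReal_integral_eq_lintegral_ofReal (integrableOn_Ioi_rpow_of_lt hlt hr)
      ((ae_restrict_mem measurableSet_Ioi).mono fun t ht => by
        have : 0 < t := hr.trans ht
        positivity)]
    refine setLIntegral_mono' measurableSet_Ioi fun t ht => ENNReal.ofReal_le_ofReal ?_
    have ht0 : 0 < t := hr.trans ht
    exact mul_le_of_le_one_right (by positivity) (min_le_left _ _)
  rw [← Set.Ioc_union_Ioi_eq_Ioi hr.le]
  refine (lintegral_union_le _ _ _).trans ((add_le_add h1 h2).trans ?_)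
  rw [← ENNReal.ofReal_add (by positivity) (by positivity)]
  exact ENNReal.ofReal_le_ofReal (le_of_eq (by ring))

theorem lintegral_const_mul_scaleProfile_le {a : ℝ} (ha : 0 < a) {p : ℕ} (hp : a < p) {r : ℝ}
    (hr : 0 < r) {c : ℝ} (hc : 0 ≤ c) :
    ∫⁻ t in Set.Ioi 0, ENNReal.ofReal (c * scaleProfile a p r t)
      ≤ ENNReal.ofReal (c * ((1 / (p - a) + 1 / a) * r ^ (-a))) := by
  simp_rw [ENNReal.ofReal_mul hc]
  rw [lintegral_const_mul' _ _ ENNReal.ofReal_ne_top]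
  gcongr
  exact lintegral_scaleProfile_le ha hp hr

variable {V W : Type*} [NormedAddCommGroup V] [NormedSpace ℝ V]
  [NormedAddCommGroup W] [NormedSpace ℝ W]

theorem exists_norm_schwartz_smul_le (f : SchwartzMap V W) (p : ℕ) :
    ∃ C : ℝ, 0 < C ∧ ∀ (z : V) (r t : ℝ), 0 < r → r ≤ ‖z‖ → 0 < t →
      ‖f (t⁻¹ • z)‖ ≤ C * min 1 ((t / r) ^ p) := by
  obtain ⟨C0, hC0, h0⟩ := f.decay 0 0
  obtain ⟨C1, hC1, h1⟩ := f.decay p 0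
  refine ⟨max C0 C1, lt_max_of_lt_left hC0, fun z r t hr hz ht => ?_⟩
  simp only [pow_zero, one_mul, norm_iteratedFDeriv_zero] at h0 h1
  rw [mul_min_of_nonneg _ _ (le_max_of_le_left hC0.le)]
  refine le_min (by simpa using (h0 _).trans (le_max_left C0 C1)) ?_
  have h2 := (h1 (t⁻¹ • z)).trans (le_max_right C0 C1)
  rw [norm_smul, norm_inv, Real.norm_of_nonneg ht.le] at h2
  have h3 : (r / t) ^ p * ‖f (t⁻¹ • z)‖ ≤ max C0 C1 := by
    refine le_trans ?_ h2
    gcongr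
    rw [div_eq_inv_mul]
    gcongr
  calc ‖f (t⁻¹ • z)‖ = ((r / t) ^ p * ‖f (t⁻¹ • z)‖) * (t / r) ^ p := by
        rw [mul_right_comm, ← mul_pow]
        field_simp
        simp
    _ ≤ _ := by gcongr

/-- Mean value inequality on the ball of radius `t⁻¹|y|` about `t⁻¹x`. Since `|y| ≤ |x|/2`, that
ball stays at distance at least `t⁻¹|x|/2` from the origin, so the decay of the derivative is
available with `r = |x|/2`. -/
theorem exists_norm_schwartz_sub_le (f : SchwartzMap V W) (p : ℕ) :
    ∃ C : ℝ, 0 < C ∧ ∀ (x y : V) (t : ℝ), x ≠ 0 → 2 * ‖y‖ ≤ ‖x‖ → 0 < t →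
      ‖f (t⁻¹ • (x - y)) - f (t⁻¹ • x)‖ ≤ C * ‖y‖ * (t⁻¹ * min 1 ((t / (‖x‖ / 2)) ^ p)) := by
  obtain ⟨C, hC, h⟩ := exists_norm_schwartz_smul_le (SchwartzMap.fderivCLM ℝ V W f) p
  refine ⟨C, hC, fun x y t hx hxy ht => ?_⟩
  have hx0 : 0 < ‖x‖ := norm_pos_iff.2 hx
  have key := Convex.norm_image_sub_le_of_norm_fderiv_le (𝕜 := ℝ) (f := f)
    (C := C * min 1 ((t / (‖x‖ / 2)) ^ p)) (s := Metric.closedBall (t⁻¹ • x) (t⁻¹ * ‖y‖))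
    (x := t⁻¹ • x) (y := t⁻¹ • (x - y))
    (fun z _ => f.differentiableAt) (fun z hz => ?_) (convex_closedBall _ _)
    (Metric.mem_closedBall_self (by positivity)) ?_
  · refine key.trans (le_of_eq ?_)
    rw [← smul_sub, sub_sub_cancel_left, norm_smul, norm_neg, norm_inv, Real.norm_of_nonneg ht.le]
    ring
  · have h1 := h (t • z) (‖x‖ / 2) t (by positivity) ?_ ht
    · rwa [smul_smul, inv_mul_cancel₀ ht.ne', one_smul, SchwartzMap.fderivCLM_apply] at h1
    · rw [mem_closedBall_iff_norm] at hz
      have h2 : ‖t • z - x‖ ≤ ‖y‖ := by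
        have : t • z - x = t • (z - t⁻¹ • x) := by
          rw [smul_sub, smul_smul, mul_inv_cancel₀ ht.ne', one_smul]
        rw [this, norm_smul, Real.norm_of_nonneg ht.le]
        calc t * ‖z - t⁻¹ • x‖ ≤ t * (t⁻¹ * ‖y‖) := by gcongr
          _ = ‖y‖ := by field_simp
      have h3 := norm_sub_norm_le x (x - t • z)
      rw [sub_sub_cancel, norm_sub_rev x] at h3
      linarith
  · rw [mem_closedBall_iff_norm, ← smul_sub, sub_sub_cancel_left, norm_smul, norm_neg, norm_inv,
      Real.norm_of_nonneg ht.le]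

theorem exists_norm_schwartz_sub_zero_le (f : SchwartzMap V W) :
    ∃ C : ℝ, 0 < C ∧ ∀ z : V, ‖f 0 - f z‖ ≤ C * ‖z‖ := by
  obtain ⟨C, hC, h⟩ := f.decay 0 1
  refine ⟨C, hC, fun z => ?_⟩
  have := Convex.norm_image_sub_le_of_norm_fderiv_le (𝕜 := ℝ) (f := f)
    (C := C) (s := Set.univ) (x := z) (y := 0)
    (fun z _ => f.differentiableAt) (fun z _ => ?_) convex_univ trivial trivial
  · simpa using this
  · have := h z
    rwa [pow_zero, one_mul, norm_iteratedFDeriv_one] at this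

theorem exists_norm_schwartz_le_rpow (f : SchwartzMap V W) {a : ℝ} (ha : 0 ≤ a) :
    ∃ C : ℝ, 0 < C ∧ ∀ z : V, z ≠ 0 → ‖f z‖ ≤ C * ‖z‖ ^ (-a) := by
  obtain ⟨p, hp⟩ := exists_nat_ge a
  obtain ⟨C, hC, h⟩ := exists_norm_schwartz_smul_le f p
  refine ⟨C, hC, fun z hz => ?_⟩
  have hz0 : 0 < ‖z‖ := norm_pos_iff.2 hz
  have h1 := h z ‖z‖ 1 hz0 le_rfl one_pos
  rw [inv_one, one_smul] at h1
  refine h1.trans ?_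
  gcongr
  rcases le_total ‖z‖ 1 with h2 | h2
  · exact (min_le_left _ _).trans (Real.one_le_rpow_of_pos_of_le_one_of_nonpos hz0 h2 (by linarith))
  · refine (min_le_right _ _).trans ?_
    rw [one_div, inv_pow, ← Real.rpow_natCast, ← Real.rpow_neg hz0.le]
    exact Real.rpow_le_rpow_of_exponent_le h2 (by linarith)

end Kernel

/-! ### Bounds for the corrected kernel -/

section KernelBound

variable {V E F : Type*} [NormedAddCommGroup V] [NormedSpace ℝ V]
  [NormedAddCommGroup E] [NormedSpace ℂ E] [NormedAddCommGroup F] [NormedSpace ℂ F]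

/-- The kernel `|y| |x|^{-(a+1)}` on the region `|x| ≥ 2|y|`. -/
noncomputable def farKernel (a : ℝ) (x y : V) : ℝ≥0∞ :=
  ‖y‖ₑ * (Metric.ball (0 : V) (2 * ‖y‖))ᶜ.indicator (fun x => ‖x‖ₑ ^ (-(a + 1))) x

/-- The kernel `|x - y|^{-a}` on the region `|x| < 4|y|`. -/
noncomputable def nearKernel (a : ℝ) (x y : V) : ℝ≥0∞ :=
  (Metric.ball (0 : V) (4 * ‖y‖)).indicator (fun x => ‖x - y‖ₑ ^ (-a)) x

open Classical in
/-- The kernel `k(t⁻¹(x - y))`, corrected for `x ≠ 0` by the product of `k(t⁻¹ x)` and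
`Φ(|x|⁻¹ y)`. -/
noncomputable def correctedKernel (k : V → F →L[ℂ] E) (Φ : V → F →L[ℂ] F) (x y : V) (t : ℝ) : F →L[ℂ] E :=
  k (t⁻¹ • (x - y)) - (if x = 0 then 0 else k (t⁻¹ • x)) ∘L Φ (‖x‖⁻¹ • y)

/-- As `Φ(0) = id`, the kernel is `(k(t⁻¹(x-y)) - k(t⁻¹x)) + k(t⁻¹x)(Φ(0) - Φ(y/|x|))`. The first
difference gains `|y|/t`, which raises the exponent of the profile to `a + 1`; the second gains
`|y|/|x|` outright. -/
theorem exists_lintegral_correctedKernel_le_far (k : SchwartzMap V (F →L[ℂ] E))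
    (Φ : SchwartzMap V (F →L[ℂ] F)) (hΦ : Φ 0 = ContinuousLinearMap.id ℂ F) {a : ℝ} (ha : 0 < a) :
    ∃ C : ℝ, 0 < C ∧ ∀ x y : V, x ≠ 0 → 2 * ‖y‖ ≤ ‖x‖ →
      ∫⁻ t in Set.Ioi 0, ‖t ^ (-a - 1) • correctedKernel k Φ x y t‖ₑ
        ≤ ENNReal.ofReal (C * (‖y‖ * ‖x‖ ^ (-(a + 1)))) := by
  obtain ⟨p, hp⟩ := exists_nat_gt (a + 1)
  obtain ⟨C0, hC0, h0⟩ := exists_norm_schwartz_smul_le k p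
  obtain ⟨C1, hC1, h1⟩ := exists_norm_schwartz_sub_le k p
  obtain ⟨C2, hC2, h2⟩ := exists_norm_schwartz_sub_zero_le Φ
  have hpa : 0 < (p : ℝ) - a := by linarith
  have hpa' : 0 < (p : ℝ) - (a + 1) := by linarith
  refine ⟨C1 * (1 / (p - (a + 1)) + 1 / (a + 1)) * (1 / 2 : ℝ) ^ (-(a + 1))
    + C0 * C2 * (1 / (p - a) + 1 / a), by positivity, fun x y hx hxy => ?_⟩
  have hx0 : 0 < ‖x‖ := norm_pos_iff.2 hx
  have hpt : ∀ t ∈ Set.Ioi (0 : ℝ), ‖t ^ (-a - 1) • correctedKernel k Φ x y t‖ₑ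
      ≤ ENNReal.ofReal (C1 * ‖y‖ * scaleProfile (a + 1) p (‖x‖ / 2) t)
        + ENNReal.ofReal (C0 * C2 * ‖y‖ * ‖x‖⁻¹ * scaleProfile a p ‖x‖ t) := by
    intro t ht
    have ht0 : (0 : ℝ) < t := ht
    rw [← ENNReal.ofReal_add
      (mul_nonneg (by positivity) (scaleProfile_nonneg _ _ (by positivity) ht0))
      (mul_nonneg (by positivity) (scaleProfile_nonneg _ _ (by positivity) ht0)),
      ← ofReal_norm]
    refine ENNReal.ofReal_le_ofReal ?_
    have hsplit : correctedKernel k Φ x y t = (k (t⁻¹ • (x - y)) - k (t⁻¹ • x))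
        + k (t⁻¹ • x) ∘L (Φ 0 - Φ (‖x‖⁻¹ • y)) := by
      rw [correctedKernel, if_neg hx, hΦ]
      ext v
      simp
    have hn : ‖correctedKernel k Φ x y t‖
        ≤ C1 * ‖y‖ * (t⁻¹ * min 1 ((t / (‖x‖ / 2)) ^ p))
          + C0 * min 1 ((t / ‖x‖) ^ p) * (C2 * (‖x‖⁻¹ * ‖y‖)) := by
      rw [hsplit]
      refine (norm_add_le _ _).trans (add_le_add (h1 x y t hx hxy ht0) ?_)
      refine (ContinuousLinearMap.opNorm_comp_le _ _).trans ?_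
      have h3 := h2 (‖x‖⁻¹ • y)
      rw [norm_smul, norm_inv, norm_norm] at h3
      exact mul_le_mul (h0 x ‖x‖ t hx0 le_rfl ht0) h3 (norm_nonneg _) (by positivity)
    rw [norm_smul, Real.norm_of_nonneg (by positivity)]
    refine (mul_le_mul_of_nonneg_left hn (by positivity)).trans (le_of_eq ?_)
    have hr : t ^ (-(a + 1) - 1) = t ^ (-a - 1) * t⁻¹ := by
      rw [← div_eq_mul_inv, ← Real.rpow_sub_one ht0.ne', neg_add']
    rw [scaleProfile, scaleProfile, hr]
    ring
  refine (setLIntegral_mono' measurableSet_Ioi hpt).trans ?_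
  rw [lintegral_add_left ((measurable_scaleProfile _ _ _).const_mul _).ennreal_ofReal]
  refine (add_le_add
    (lintegral_const_mul_scaleProfile_le (by linarith) hp (by positivity) (by positivity))
    (lintegral_const_mul_scaleProfile_le ha (by linarith) hx0 (by positivity))).trans ?_
  rw [← ENNReal.ofReal_add (by positivity) (by positivity)]
  refine ENNReal.ofReal_le_ofReal (le_of_eq ?_)
  rw [div_eq_mul_one_div ‖x‖, Real.mul_rpow hx0.le (by norm_num),
    show -(a + 1) = -a - 1 by ring, Real.rpow_sub_one hx0.ne']
  ring

/-- The two terms are estimated separately. The correction contributes `|x|^{-a}`, singular at the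
origin, but the decay `|Φ(y/|x|)| ≤ C(|x|/|y|)^a` turns it into `|y|^{-a}`, and `|x - y| ≤ 3|y|`
here. -/
theorem exists_lintegral_correctedKernel_le_near (k : SchwartzMap V (F →L[ℂ] E))
    (Φ : SchwartzMap V (F →L[ℂ] F)) {a : ℝ} (ha : 0 < a) :
    ∃ C : ℝ, 0 < C ∧ ∀ x y : V, x ≠ y → ‖x‖ < 2 * ‖y‖ →
      ∫⁻ t in Set.Ioi 0, ‖t ^ (-a - 1) • correctedKernel k Φ x y t‖ₑ
        ≤ ENNReal.ofReal (C * ‖x - y‖ ^ (-a)) := by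
  obtain ⟨p, hp⟩ := exists_nat_gt a
  obtain ⟨C0, hC0, h0⟩ := exists_norm_schwartz_smul_le k p
  obtain ⟨C2, hC2, h2⟩ := exists_norm_schwartz_le_rpow Φ ha.le
  have hpa : 0 < (p : ℝ) - a := by linarith
  refine ⟨C0 * (1 / (p - a) + 1 / a) * (1 + C2 * (1 / 3) ^ (-a)), by positivity,
    fun x y hxy hlt => ?_⟩
  have hd : 0 < ‖x - y‖ := norm_pos_iff.2 (sub_ne_zero.2 hxy)
  have hy : 0 < ‖y‖ := by linarith [norm_nonneg x]
  rcases eq_or_ne x 0 with rfl | hx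
  · have hpt : ∀ t ∈ Set.Ioi (0 : ℝ), ‖t ^ (-a - 1) • correctedKernel k Φ 0 y t‖ₑ
        ≤ ENNReal.ofReal (C0 * scaleProfile a p ‖0 - y‖ t) := by
      intro t ht
      have ht0 : (0 : ℝ) < t := ht
      rw [← ofReal_norm, norm_smul, Real.norm_of_nonneg (by positivity)]
      refine ENNReal.ofReal_le_ofReal ?_
      rw [correctedKernel, if_pos rfl, ContinuousLinearMap.zero_comp, sub_zero, scaleProfile,
        mul_left_comm]
      gcongr
      exact h0 _ _ t hd le_rfl ht0
    refine (setLIntegral_mono' measurableSet_Ioi hpt).trans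
      ((lintegral_const_mul_scaleProfile_le ha hp hd hC0.le).trans
        (ENNReal.ofReal_le_ofReal ?_))
    rw [← mul_assoc]
    refine mul_le_mul_of_nonneg_right (le_mul_of_one_le_right (by positivity) ?_) (by positivity)
    linarith [show 0 ≤ C2 * (1 / 3 : ℝ) ^ (-a) by positivity]
  · have hx0 : 0 < ‖x‖ := norm_pos_iff.2 hx
    have hΦ := h2 (‖x‖⁻¹ • y) (smul_ne_zero (inv_ne_zero hx0.ne') (norm_pos_iff.1 hy))
    rw [norm_smul, norm_inv, norm_norm, Real.mul_rpow (by positivity) (by positivity),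
      Real.inv_rpow hx0.le] at hΦ
    have hpt : ∀ t ∈ Set.Ioi (0 : ℝ), ‖t ^ (-a - 1) • correctedKernel k Φ x y t‖ₑ
        ≤ ENNReal.ofReal (C0 * scaleProfile a p ‖x - y‖ t) + ENNReal.ofReal
          (C0 * (C2 * ((‖x‖ ^ (-a))⁻¹ * ‖y‖ ^ (-a))) * scaleProfile a p ‖x‖ t) := by
      intro t ht
      have ht0 : (0 : ℝ) < t := ht
      rw [← ENNReal.ofReal_add
        (mul_nonneg (by positivity) (scaleProfile_nonneg _ _ (by positivity) ht0))
        (mul_nonneg (by positivity) (scaleProfile_nonneg _ _ (by positivity) ht0)),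
        ← ofReal_norm, norm_smul, Real.norm_of_nonneg (by positivity)]
      refine ENNReal.ofReal_le_ofReal ?_
      have hn : ‖correctedKernel k Φ x y t‖ ≤ C0 * min 1 ((t / ‖x - y‖) ^ p)
          + C0 * min 1 ((t / ‖x‖) ^ p) * (C2 * ((‖x‖ ^ (-a))⁻¹ * ‖y‖ ^ (-a))) := by
        rw [correctedKernel, if_neg hx]
        refine (norm_sub_le _ _).trans (add_le_add (h0 _ _ t hd le_rfl ht0) ?_)
        refine (ContinuousLinearMap.opNorm_comp_le _ _).trans ?_
        exact mul_le_mul (h0 x ‖x‖ t hx0 le_rfl ht0) hΦ (norm_nonneg _) (by positivity)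
      refine (mul_le_mul_of_nonneg_left hn (by positivity)).trans (le_of_eq ?_)
      rw [scaleProfile, scaleProfile]
      ring
    refine (setLIntegral_mono' measurableSet_Ioi hpt).trans ?_
    rw [lintegral_add_left ((measurable_scaleProfile _ _ _).const_mul _).ennreal_ofReal]
    refine (add_le_add
      (lintegral_const_mul_scaleProfile_le ha hp hd (by positivity))
      (lintegral_const_mul_scaleProfile_le ha hp hx0 (by positivity))).trans ?_
    rw [← ENNReal.ofReal_add (by positivity) (by positivity)]
    refine ENNReal.ofReal_le_ofReal ?_
    have h3 : ‖y‖ ^ (-a) ≤ (1 / 3) ^ (-a) * ‖x - y‖ ^ (-a) := by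
      rw [← Real.mul_rpow (by norm_num) hd.le]
      refine Real.rpow_le_rpow_of_nonpos (by positivity) ?_ (by linarith)
      linarith [norm_sub_le x y]
    have h4 : ‖x‖ ^ (-a) ≠ 0 := (Real.rpow_pos_of_pos hx0 _).ne'
    calc _ = C0 * (1 / (p - a) + 1 / a) * (‖x - y‖ ^ (-a) + C2 * ‖y‖ ^ (-a)) := by
          field_simp
      _ ≤ C0 * (1 / (p - a) + 1 / a)
          * (‖x - y‖ ^ (-a) + C2 * ((1 / 3) ^ (-a) * ‖x - y‖ ^ (-a))) := by gcongr
      _ = _ := by ring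

theorem exists_lintegral_correctedKernel_le (k : SchwartzMap V (F →L[ℂ] E))
    (Φ : SchwartzMap V (F →L[ℂ] F)) (hΦ : Φ 0 = ContinuousLinearMap.id ℂ F) {a : ℝ} (ha : 0 < a) :
    ∃ C : ℝ≥0, ∀ x y : V, y ≠ 0 → x ≠ y →
      ∫⁻ t in Set.Ioi 0, ‖t ^ (-a - 1) • correctedKernel k Φ x y t‖ₑ
        ≤ C * (farKernel a x y + nearKernel a x y) := by
  obtain ⟨C1, hC1, h1⟩ := exists_lintegral_correctedKernel_le_far k Φ hΦ ha
  obtain ⟨C2, hC2, h2⟩ := exists_lintegral_correctedKernel_le_near k Φ ha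
  refine ⟨Real.toNNReal (max C1 C2), fun x y hy hxy => ?_⟩
  have hy0 : 0 < ‖y‖ := norm_pos_iff.2 hy
  change _ ≤ ENNReal.ofReal (max C1 C2) * _
  rcases le_or_gt (2 * ‖y‖) ‖x‖ with h | h
  · have hx0 : 0 < ‖x‖ := by linarith
    refine (h1 x y (norm_pos_iff.1 hx0) h).trans ?_
    rw [ENNReal.ofReal_mul hC1.le]
    gcongr
    · exact le_max_left _ _
    · refine le_add_right (le_of_eq ?_)
      rw [farKernel, Set.indicator_of_mem (by simpa using h), ENNReal.ofReal_mul hy0.le,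
        ← ENNReal.ofReal_rpow_of_pos hx0, ofReal_norm, ofReal_norm]
  · refine (h2 x y hxy h).trans ?_
    rw [ENNReal.ofReal_mul hC2.le]
    gcongr
    · exact le_max_right _ _
    · refine le_add_left (le_of_eq ?_)
      rw [nearKernel, Set.indicator_of_mem (by simp; linarith),
        ← ENNReal.ofReal_rpow_of_pos (norm_pos_iff.2 (sub_ne_zero.2 hxy)), ofReal_norm]

end KernelBound

/-! ### Radial partition of unity over dilations -/

section Cutoff

/-- A smooth radial cutoff, supported in an annulus, whose dilations form a partition of unity. -/
structure RadialCutoff (V : Type*) [NormedAddCommGroup V] [InnerProductSpace ℝ V] where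
  toFun : V → ℝ
  contDiff : ContDiff ℝ ∞ toFun
  hasCompactSupport : HasCompactSupport toFun
  eventually_zero : ∀ᶠ ξ in 𝓝 0, toFun ξ = 0
  nonneg : ∀ ξ, 0 ≤ toFun ξ
  integrableOn : ∀ ξ, ξ ≠ 0 → IntegrableOn (fun t : ℝ => t⁻¹ * toFun (t • ξ)) (Set.Ioi 0)
  integral_eq_one : ∀ ξ, ξ ≠ 0 → ∫ t in Set.Ioi (0 : ℝ), t⁻¹ * toFun (t • ξ) = 1

instance (V : Type*) [NormedAddCommGroup V] [InnerProductSpace ℝ V] :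
    CoeFun (RadialCutoff V) fun _ => V → ℝ := ⟨RadialCutoff.toFun⟩

theorem nonempty_radialCutoff (V : Type*) [NormedAddCommGroup V] [InnerProductSpace ℝ V]
    [FiniteDimensional ℝ V] : Nonempty (RadialCutoff V) := by
  -- The cutoff is a multiple of `θ(|ξ|²)`: the square keeps it smooth, and the support `(1, 3)` of
  -- `θ` keeps it away from the origin. By invariance of `dt/t` the normalizing integral does not
  -- depend on `ξ`.
  let θ : ContDiffBump (2 : ℝ) := ⟨1 / 2, 1, by norm_num, by norm_num⟩
  let G : ℝ → ℝ := fun s => s⁻¹ * θ (s ^ 2)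
  have hsupp : Function.support θ = Set.Ioo 1 3 := by
    rw [θ.support_eq, Real.ball_eq_Ioo]; norm_num [θ]
  have hzero : ∀ s : ℝ, s ∉ Set.Ioo (1 : ℝ) 3 → θ s = 0 := fun s hs => by
    by_contra h
    exact hs (hsupp ▸ (Function.mem_support.2 h))
  have hGint : IntegrableOn G (Set.Ioi 0) := by
    have h1 : IntegrableOn G (Set.Icc 1 2) := by
      refine ContinuousOn.integrableOn_Icc ?_
      refine ContinuousOn.mul (continuousOn_inv₀.mono fun s hs => ?_) ?_
      · exact (lt_of_lt_of_le one_pos hs.1).ne'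
      · exact (θ.continuous.comp (continuous_pow 2)).continuousOn
    refine h1.of_forall_sdiff_eq_zero measurableSet_Ioi fun s hs => ?_
    have : θ (s ^ 2) = 0 := hzero _ fun h => hs.2 ⟨?_, ?_⟩
    · simp [G, this]
    · have := Set.mem_Ioi.1 hs.1; nlinarith [h.1]
    · have := Set.mem_Ioi.1 hs.1; nlinarith [h.2]
  have hGnn : ∀ s ∈ Set.Ioi (0 : ℝ), 0 ≤ G s := fun s hs =>
    mul_nonneg (inv_nonneg.2 (le_of_lt hs)) θ.nonneg
  have hc : 0 < ∫ s in Set.Ioi (0 : ℝ), G s := by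
    rw [setIntegral_pos_iff_support_of_nonneg_ae
      ((ae_restrict_mem measurableSet_Ioi).mono hGnn) hGint]
    refine lt_of_lt_of_le (b := volume (Set.Ioo (1.1 : ℝ) 1.2)) ?_ (measure_mono fun s hs => ?_)
    · rw [Real.volume_Ioo]; norm_num
    · have h0 : (0 : ℝ) < s := by linarith [hs.1]
      refine ⟨mul_ne_zero (inv_ne_zero h0.ne') ?_, h0⟩
      have : s ^ 2 ∈ Function.support θ := by
        rw [hsupp]
        constructor <;> nlinarith [hs.1, hs.2]
      exact this
  set c := ∫ s in Set.Ioi (0 : ℝ), G s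
  have hscale : ∀ ξ : V, ∀ t : ℝ, t⁻¹ * (c⁻¹ * θ (‖t • ξ‖ ^ 2)) = c⁻¹ * ‖ξ‖ * G (t * ‖ξ‖) := by
    intro ξ t
    rcases eq_or_ne ξ 0 with rfl | hξ
    · simp [hzero 0 (by norm_num)]
    have : ‖ξ‖ ≠ 0 := norm_ne_zero_iff.2 hξ
    simp only [G, norm_smul, mul_pow, Real.norm_eq_abs, sq_abs, mul_inv]
    field_simp
  refine ⟨⟨fun ξ => c⁻¹ * θ (‖ξ‖ ^ 2), ?_, ?_, ?_, ?_, ?_, ?_⟩⟩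
  · exact contDiff_const.mul (θ.contDiff.comp (contDiff_norm_sq ℝ))
  · refine HasCompactSupport.intro (isCompact_closedBall (0 : V) 2) fun ξ hξ => ?_
    rw [mem_closedBall_zero_iff, not_le] at hξ
    rw [hzero _ fun h => ?_, mul_zero]
    nlinarith [h.2]
  · filter_upwards [Metric.ball_mem_nhds (0 : V) one_pos] with ξ hξ
    rw [mem_ball_zero_iff] at hξ
    rw [hzero _ fun h => ?_, mul_zero]
    nlinarith [h.1, norm_nonneg ξ]
  · exact fun ξ => mul_nonneg (inv_nonneg.2 hc.le) θ.nonneg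
  · intro ξ hξ
    simp_rw [hscale]
    refine Integrable.const_mul ?_ _
    have := (integrableOn_Ioi_comp_mul_right_iff G 0 (norm_pos_iff.2 hξ)).2
    rw [zero_mul] at this
    exact this hGint
  · intro ξ hξ
    have h0 : ‖ξ‖ ≠ 0 := norm_ne_zero_iff.2 hξ
    simp_rw [hscale]
    rw [integral_const_mul, integral_comp_mul_right_Ioi G 0 (norm_pos_iff.2 hξ), zero_mul,
      smul_eq_mul]
    change c⁻¹ * ‖ξ‖ * (‖ξ‖⁻¹ * c) = 1
    field_simp

end Cutoff

section CutoffLemmas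

variable {V : Type*} [NormedAddCommGroup V] [InnerProductSpace ℝ V]

namespace RadialCutoff

variable (χ : RadialCutoff V) {W : Type*} [NormedAddCommGroup W] [NormedSpace ℝ W]

theorem zero_eq_zero : χ 0 = 0 := χ.eventually_zero.self_of_nhds

theorem exists_pos {ξ : V} (hξ : ξ ≠ 0) : ∃ t : ℝ, 0 < t ∧ χ (t • ξ) ≠ 0 := by
  by_contra! h
  have h1 := χ.integral_eq_one ξ hξ
  rw [setIntegral_congr_fun (g := fun _ => (0 : ℝ)) measurableSet_Ioi
    (fun t ht => by simp [h t ht])] at h1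
  simp at h1

theorem contDiff_smul {h : V → W} (hh : ContDiffOn ℝ ∞ h {0}ᶜ) :
    ContDiff ℝ ∞ fun ξ => χ ξ • h ξ := by
  rw [contDiff_iff_contDiffAt]
  intro ξ
  rcases eq_or_ne ξ 0 with rfl | hξ
  · refine (contDiffAt_const (c := (0 : W))).congr_of_eventuallyEq ?_
    filter_upwards [χ.eventually_zero] with ξ hξ
    simp [hξ]
  · exact χ.contDiff.contDiffAt.smul (hh.contDiffAt (isOpen_compl_singleton.mem_nhds hξ))

theorem hasCompactSupport_smul (h : V → W) : HasCompactSupport fun ξ => χ ξ • h ξ :=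
  χ.hasCompactSupport.smul_right

end RadialCutoff

end CutoffLemmas

/-! ### Smooth homogeneous left inverse of the symbol -/

section LeftInverse

variable {V : Type*} [NormedAddCommGroup V] [NormedSpace ℝ V] {m : ℕ}

theorem contDiffAt_complex_comp {E F G : Type*} [NormedAddCommGroup E] [NormedSpace ℂ E]
    [NormedAddCommGroup F] [NormedSpace ℂ F] [NormedAddCommGroup G] [NormedSpace ℂ G]
    {S : V → F →L[ℂ] G} {T : V → E →L[ℂ] F} {n : WithTop ℕ∞} {ξ : V}
    (hS : ContDiffAt ℝ n S ξ) (hT : ContDiffAt ℝ n T ξ) :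
    ContDiffAt ℝ n (fun ξ => S ξ ∘L T ξ) ξ := by
  have h : ContDiff ℝ n fun p : (F →L[ℂ] G) × (E →L[ℂ] F) => p.1 ∘L p.2 :=
    (isBoundedBilinearMap_comp (𝕜 := ℂ)).contDiff.restrict_scalars ℝ
  exact h.contDiffAt.comp ξ (hS.prodMk hT)

section Inner

variable {E F : Type*} [NormedAddCommGroup E] [InnerProductSpace ℂ E] [FiniteDimensional ℂ E]
  [NormedAddCommGroup F] [InnerProductSpace ℂ F] [FiniteDimensional ℂ F]

theorem contDiff_adjoint {P : V → E →L[ℂ] F} {n : WithTop ℕ∞} (hP : ContDiff ℝ n P) :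
    ContDiff ℝ n fun ξ => ContinuousLinearMap.adjoint (P ξ) := by
  have : IsBoundedLinearMap ℝ
      (fun T : E →L[ℂ] F => (ContinuousLinearMap.adjoint T : F →L[ℂ] E)) := by
    refine ⟨⟨fun S T => map_add _ S T, fun c T => ?_⟩, 1, one_pos, fun T => ?_⟩
    · have := map_smulₛₗ (ContinuousLinearMap.adjoint (𝕜 := ℂ) (E := E) (F := F)) (c : ℂ) T
      simpa using this
    · rw [one_mul, LinearIsometryEquiv.norm_map]
  exact this.contDiff.comp hP

theorem isUnit_adjoint_comp_self {T : E →L[ℂ] F} (hT : Function.Injective T) :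
    IsUnit (ContinuousLinearMap.adjoint T ∘L T) := by
  have hinj : Function.Injective (ContinuousLinearMap.adjoint T ∘L T) := by
    rw [injective_iff_map_eq_zero]
    intro v hv
    have : inner ℂ (T v) (T v) = 0 := by
      rw [← ContinuousLinearMap.adjoint_inner_left]
      change inner ℂ ((ContinuousLinearMap.adjoint T ∘L T) v) v = 0
      rw [hv, inner_zero_left]
    exact (injective_iff_map_eq_zero T).1 hT v (inner_self_eq_zero.1 this)
  rw [ContinuousLinearMap.isUnit_iff_bijective]
  exact ⟨hinj, (LinearMap.injective_iff_surjective
    (f := ((ContinuousLinearMap.adjoint T ∘L T : E →L[ℂ] E) : E →ₗ[ℂ] E))).1 hinj⟩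

/-- The left inverse `(T* T)⁻¹ T*` of an injective operator. -/
noncomputable def pseudoInverse (T : E →L[ℂ] F) : F →L[ℂ] E :=
  Ring.inverse (ContinuousLinearMap.adjoint T ∘L T) ∘L ContinuousLinearMap.adjoint T

theorem pseudoInverse_comp {T : E →L[ℂ] F} (hT : Function.Injective T) :
    pseudoInverse T ∘L T = ContinuousLinearMap.id ℂ E := by
  rw [pseudoInverse, ContinuousLinearMap.comp_assoc]
  exact Ring.inverse_mul_cancel _ (isUnit_adjoint_comp_self hT)

theorem pseudoInverse_smul {T : E →L[ℂ] F} (hT : Function.Injective T) {c : ℝ} (hc : c ≠ 0) :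
    pseudoInverse (c • T) = c⁻¹ • pseudoInverse T := by
  have hadj : ContinuousLinearMap.adjoint (c • T) = c • ContinuousLinearMap.adjoint T := by
    have := map_smulₛₗ (ContinuousLinearMap.adjoint (𝕜 := ℂ) (E := E) (F := F)) (c : ℂ) T
    simpa using this
  have hu := isUnit_adjoint_comp_self hT
  set S := ContinuousLinearMap.adjoint T ∘L T with hS
  have hinv : Ring.inverse ((c * c) • S) = (c * c)⁻¹ • Ring.inverse S := by
    have h1 : IsUnit ((c * c) • S) := by
      rw [← isUnit_smul_iff (Units.mk0 (c * c) (mul_ne_zero hc hc))] at hu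
      exact hu
    have h2 : ((c * c)⁻¹ • Ring.inverse S) * ((c * c) • S) = 1 := by
      rw [smul_mul_smul_comm, inv_mul_cancel₀ (mul_ne_zero hc hc), one_smul,
        Ring.inverse_mul_cancel _ (isUnit_adjoint_comp_self hT)]
    calc Ring.inverse ((c * c) • S)
        = (((c * c)⁻¹ • Ring.inverse S) * ((c * c) • S)) * Ring.inverse ((c * c) • S) := by
          rw [h2, one_mul]
      _ = _ := by rw [mul_assoc, Ring.mul_inverse_cancel _ h1, mul_one]
  have hcomp : ContinuousLinearMap.adjoint (c • T) ∘L (c • T) = (c * c) • S := by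
    rw [hadj]
    ext v
    simp [hS, smul_smul]
  rw [pseudoInverse, hcomp, hinv, hadj, pseudoInverse]
  ext v
  simp only [ContinuousLinearMap.comp_apply, smul_apply, ContinuousLinearMap.map_smul_of_tower, smul_smul]
  congr 1
  field_simp

theorem contDiffAt_pseudoInverse {P : V → E →L[ℂ] F} {n : WithTop ℕ∞} (hP : ContDiff ℝ n P) {ξ : V}
    (hξ : Function.Injective (P ξ)) : ContDiffAt ℝ n (fun ξ => pseudoInverse (P ξ)) ξ := by
  have h1 := contDiff_adjoint hP
  obtain ⟨u, hu⟩ := isUnit_adjoint_comp_self hξ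
  have h2 : ContDiffAt ℝ n
      (fun ξ => Ring.inverse (ContinuousLinearMap.adjoint (P ξ) ∘L P ξ)) ξ := by
    have h3 := contDiffAt_ringInverse ℝ (n := n) u
    rw [hu] at h3
    exact h3.comp (f := fun ξ => ContinuousLinearMap.adjoint (P ξ) ∘L P ξ) ξ
      (contDiffAt_complex_comp h1.contDiffAt hP.contDiffAt)
  exact contDiffAt_complex_comp h2 h1.contDiffAt

/-- `T (T* T)⁻¹ T*` is the orthogonal projection onto the range of `T`, so the residual is
orthogonal to that range. -/
theorem inner_sub_pseudoInverse {T : E →L[ℂ] F} (hT : Function.Injective T) (f : F) :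
    (inner ℂ f (f - T (pseudoInverse T f))).re = ‖f - T (pseudoInverse T f)‖ ^ 2 := by
  have h1 : ContinuousLinearMap.adjoint T (f - T (pseudoInverse T f)) = 0 := by
    have := congrArg (fun S : E →L[ℂ] E => S (ContinuousLinearMap.adjoint T f))
      (Ring.mul_inverse_cancel _ (isUnit_adjoint_comp_self hT))
    simp only [mul_apply_eq_comp, ContinuousLinearMap.comp_apply, one_apply_eq_self] at this
    rw [map_sub, sub_eq_zero, pseudoInverse, ContinuousLinearMap.comp_apply, this]
  refine Eq.trans ?_ (inner_self_eq_norm_sq (𝕜 := ℂ) _)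
  conv_rhs => rw [inner_sub_left, ← ContinuousLinearMap.adjoint_inner_right, h1, inner_zero_right,
    sub_zero]
  rfl

end Inner

variable {E F : Type*} [NormedAddCommGroup E] [NormedSpace ℂ E] [FiniteDimensional ℂ E]
  [NormedAddCommGroup F] [NormedSpace ℂ F] [FiniteDimensional ℂ F]

/-- The norms on `E` and `F` are arbitrary, so the pseudoinverse is taken in Euclidean coordinates.
The functional `φ` is the inner product with `f` in these coordinates; the last clause keeps just
the positivity of the orthogonal projection that the averaging argument below uses. -/
theorem exists_leftInverse {P : V → E →L[ℂ] F} (hP : ContDiff ℝ ∞ P)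
    (hinj : ∀ ξ, ξ ≠ 0 → Function.Injective (P ξ))
    (hhom : ∀ (t : ℝ) (ξ : V), P (t • ξ) = t ^ m • P ξ) :
    ∃ B : V → F →L[ℂ] E, ContDiffOn ℝ ∞ B {0}ᶜ ∧
      (∀ ξ, ξ ≠ 0 → B ξ ∘L P ξ = ContinuousLinearMap.id ℂ E) ∧
      (∀ (t : ℝ) (ξ : V), 0 < t → ξ ≠ 0 → B (t • ξ) = (t ^ m)⁻¹ • B ξ) ∧
      ∀ f : F, ∃ φ : F →L[ℂ] ℂ, ∀ ξ, ξ ≠ 0 → 0 ≤ (φ (f - P ξ (B ξ f))).re ∧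
        ((φ (f - P ξ (B ξ f))).re = 0 → f = P ξ (B ξ f)) := by
  let eE : E ≃L[ℂ] EuclideanSpace ℂ (Fin (Module.finrank ℂ E)) :=
    ContinuousLinearEquiv.ofFinrankEq (by simp)
  let eF : F ≃L[ℂ] EuclideanSpace ℂ (Fin (Module.finrank ℂ F)) :=
    ContinuousLinearEquiv.ofFinrankEq (by simp)
  let Q : V → EuclideanSpace ℂ (Fin (Module.finrank ℂ E)) →L[ℂ]
      EuclideanSpace ℂ (Fin (Module.finrank ℂ F)) :=
    fun ξ => (eF : F →L[ℂ] _) ∘L P ξ ∘L (eE.symm : _ →L[ℂ] E)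
  have hQ : ContDiff ℝ ∞ Q := contDiff_iff_contDiffAt.2 fun ξ =>
    contDiffAt_complex_comp contDiffAt_const (contDiffAt_complex_comp hP.contDiffAt contDiffAt_const)
  have hQinj : ∀ ξ, ξ ≠ 0 → Function.Injective (Q ξ) := fun ξ hξ =>
    eF.injective.comp ((hinj ξ hξ).comp eE.symm.injective)
  refine ⟨fun ξ => (eE.symm : _ →L[ℂ] E) ∘L pseudoInverse (Q ξ) ∘L (eF : F →L[ℂ] _),
    fun ξ hξ => ?_, fun ξ hξ => ?_, fun t ξ ht hξ => ?_, fun f => ?_⟩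
  · exact (contDiffAt_complex_comp contDiffAt_const (contDiffAt_complex_comp
      (contDiffAt_pseudoInverse hQ (hQinj ξ hξ)) contDiffAt_const)).contDiffWithinAt
  · ext v
    have := congrArg (fun S => S (eE v)) (pseudoInverse_comp (hQinj ξ hξ))
    simp [Q] at this
    simp [Q, this]
  · have h1 : Q (t • ξ) = t ^ m • Q ξ := by
      ext v
      simp [Q, hhom]
    simp only [h1, pseudoInverse_smul (hQinj ξ hξ) (pow_ne_zero m ht.ne')]
    ext v
    simp
  · refine ⟨innerSL ℂ (eF f) ∘L (eF : F →L[ℂ] _), fun ξ hξ => ?_⟩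
    have h1 := inner_sub_pseudoInverse (hQinj ξ hξ) (eF f)
    have h2 : eF (f - P ξ (eE.symm (pseudoInverse (Q ξ) (eF f))))
        = eF f - Q ξ (pseudoInverse (Q ξ) (eF f)) := by simp [Q]
    have h3 : (innerSL ℂ (eF f) (eF (f - P ξ (eE.symm (pseudoInverse (Q ξ) (eF f)))))).re
        = ‖eF (f - P ξ (eE.symm (pseudoInverse (Q ξ) (eF f))))‖ ^ 2 := by
      rw [h2, innerSL_apply_apply, h1]
    simp only [ContinuousLinearMap.comp_apply, ContinuousLinearEquiv.coe_coe]
    rw [h3]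
    refine ⟨by positivity, fun h => ?_⟩
    rw [sq_eq_zero_iff, norm_eq_zero, map_eq_zero_iff _ eF.injective, sub_eq_zero] at h
    exact h

end LeftInverse

/-! ### Cancellation and the averaged annihilator -/

section Annihilator

variable {V : Type*} [NormedAddCommGroup V] [InnerProductSpace ℝ V] [MeasurableSpace V]
  [BorelSpace V] {μ : Measure V} [IsFiniteMeasureOnCompacts μ] [μ.IsOpenPosMeasure]
  {E F : Type*} [NormedAddCommGroup E] [NormedSpace ℂ E] [FiniteDimensional ℂ E]
  [NormedAddCommGroup F] [NormedSpace ℂ F] [FiniteDimensional ℂ F] {m : ℕ}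

/-- Let `Q = id - P B`, which kills the range of `P`, and `S = ∫ χ Q`. If `S f = 0`, pairing with
`φ` gives a continuous nonnegative integrand of integral zero, so `Q(ξ) f = 0` wherever `χ(ξ) ≠ 0`.
Then `f` lies in every range and vanishes by cancellation. Thus `S` is invertible and `Ψ = S⁻¹ χ Q`.
-/
theorem exists_annihilator_integral_eq_id (χ : RadialCutoff V) {P : V → E →L[ℂ] F}
    (hP : ContDiff ℝ ∞ P) (hinj : ∀ ξ, ξ ≠ 0 → Function.Injective (P ξ))
    (hhom : ∀ (t : ℝ) (ξ : V), P (t • ξ) = t ^ m • P ξ)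
    (hcan : ∀ f : F, (∀ ξ, ξ ≠ 0 → f ∈ Set.range (P ξ)) → f = 0) :
    ∃ Ψ : V → F →L[ℂ] F, ContDiff ℝ ∞ Ψ ∧ HasCompactSupport Ψ ∧
      (∀ ξ e, Ψ ξ (P ξ e) = 0) ∧ ∫ ξ, Ψ ξ ∂μ = ContinuousLinearMap.id ℂ F := by
  obtain ⟨B, hBs, hBP, -, hφ⟩ := exists_leftInverse hP hinj hhom
  let Q : V → F →L[ℂ] F := fun ξ => ContinuousLinearMap.id ℂ F - P ξ ∘L B ξ
  have hQs : ContDiffOn ℝ ∞ Q {0}ᶜ := fun ξ hξ =>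
    (contDiffAt_const.sub (contDiffAt_complex_comp hP.contDiffAt
      (hBs.contDiffAt (isOpen_compl_singleton.mem_nhds hξ)))).contDiffWithinAt
  have hQP : ∀ ξ, ξ ≠ 0 → ∀ e, Q ξ (P ξ e) = 0 := fun ξ hξ e => by
    have := congrArg (fun S => S e) (hBP ξ hξ)
    simp only [ContinuousLinearMap.comp_apply, ContinuousLinearMap.id_apply] at this
    simp [Q, this]
  have hsm : ContDiff ℝ ∞ fun ξ => χ ξ • Q ξ := χ.contDiff_smul hQs
  have hcs : HasCompactSupport fun ξ => χ ξ • Q ξ := χ.hasCompactSupport_smul Q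
  have hint : Integrable (fun ξ => χ ξ • Q ξ) μ := hsm.continuous.integrable_of_hasCompactSupport hcs
  set S : F →L[ℂ] F := ∫ ξ, χ ξ • Q ξ ∂μ with hS
  have hSinj : Function.Injective S := by
    rw [injective_iff_map_eq_zero]
    intro f hf
    obtain ⟨φ, hφ⟩ := hφ f
    let L : (F →L[ℂ] F) →L[ℝ] ℝ := Complex.reCLM ∘L
      (φ.restrictScalars ℝ ∘L (ContinuousLinearMap.apply ℂ F f).restrictScalars ℝ)
    have hL : ∫ ξ, L (χ ξ • Q ξ) ∂μ = 0 := by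
      rw [L.integral_comp_comm hint, ← hS]
      simp [L, hf]
    have hLnn : ∀ ξ, 0 ≤ L (χ ξ • Q ξ) := fun ξ => by
      rcases eq_or_ne ξ 0 with rfl | hξ
      · simp [χ.zero_eq_zero]
      · rw [map_smul]
        exact mul_nonneg (χ.nonneg ξ) (hφ ξ hξ).1
    have hL0 : ∀ ξ, L (χ ξ • Q ξ) = 0 := fun ξ => by
      by_contra hne
      refine (Continuous.integral_pos_of_hasCompactSupport_nonneg_nonzero (μ := μ)
        (L.continuous.comp hsm.continuous) (hcs.comp_left (map_zero L)) hLnn hne).ne' ?_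
      exact hL
    -- Every ray meets the set `χ ≠ 0`, and by homogeneity the range of `P` is constant along rays.
    refine hcan f fun ξ hξ => ?_
    obtain ⟨t, ht, hχt⟩ := χ.exists_pos hξ
    have h1 := hL0 (t • ξ)
    rw [map_smul, smul_eq_mul, mul_eq_zero, or_iff_right hχt] at h1
    have h2 := (hφ (t • ξ) (smul_ne_zero ht.ne' hξ)).2 h1
    refine ⟨t ^ m • B (t • ξ) f, ?_⟩
    rw [ContinuousLinearMap.map_smul_of_tower, ← smul_apply, ← hhom, ← h2]
  have hSu : IsUnit S := by
    rw [ContinuousLinearMap.isUnit_iff_bijective]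
    exact ⟨hSinj, (LinearMap.injective_iff_surjective (f := (S : F →ₗ[ℂ] F))).1 hSinj⟩
  refine ⟨fun ξ => Ring.inverse S ∘L (χ ξ • Q ξ), ?_, ?_, fun ξ e => ?_, ?_⟩
  · exact contDiff_iff_contDiffAt.2 fun ξ =>
      contDiffAt_complex_comp contDiffAt_const hsm.contDiffAt
  · exact hcs.comp_left (g := fun T => Ring.inverse S ∘L T) (ContinuousLinearMap.comp_zero _)
  · rcases eq_or_ne ξ 0 with rfl | hξ
    · simp [χ.zero_eq_zero]
    · simp [hQP ξ hξ e]
  · have := (ContinuousLinearMap.compL ℂ F F F (Ring.inverse S)).integral_comp_comm hint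
    simp only [ContinuousLinearMap.compL_apply] at this
    rw [this, ← hS]
    exact Ring.inverse_mul_cancel S hSu

end Annihilator

/-! ### The symbol and the Fourier transform of `A(D)u` -/

section Symbol

variable {N m : ℕ} {E F : Type*}
  [NormedAddCommGroup E] [NormedSpace ℂ E] [FiniteDimensional ℂ E]
  [NormedAddCommGroup F] [NormedSpace ℂ F]

namespace HomDiffOp

variable (A : HomDiffOp N m E F)

/-- The symbol as a continuous linear map. -/
noncomputable def symbolCLM (ξ : RN N) : E →L[ℂ] F := LinearMap.toContinuousLinearMap (A.symbol ξ)

@[simp]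
theorem symbolCLM_apply (ξ : RN N) (e : E) : A.symbolCLM ξ e = A.symbol ξ e := rfl

theorem symbolCLM_eq_sum (ξ : RN N) : A.symbolCLM ξ = ∑ α : multiIndices N m,
    (∏ i, ξ i ^ α.1 i : ℝ) • LinearMap.toContinuousLinearMap (A.coeff α) := by
  ext e
  rw [symbolCLM_apply, symbol, LinearMap.sum_apply, sum_apply]
  exact Finset.sum_congr rfl fun α _ => Complex.coe_smul _ _

theorem contDiff_symbolCLM : ContDiff ℝ ∞ A.symbolCLM := by
  simp_rw [funext A.symbolCLM_eq_sum]
  refine ContDiff.sum fun α _ => ContDiff.fun_smul (contDiff_prod fun i _ => ?_) contDiff_const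
  exact (EuclideanSpace.proj (𝕜 := ℝ) i).contDiff.pow _

theorem symbolCLM_smul (t : ℝ) (ξ : RN N) : A.symbolCLM (t • ξ) = t ^ m • A.symbolCLM ξ := by
  rw [symbolCLM_eq_sum, symbolCLM_eq_sum, Finset.smul_sum]
  refine Finset.sum_congr rfl fun α _ => ?_
  have hm : t ^ m = ∏ i, t ^ α.1 i := by
    rw [Finset.prod_pow_eq_pow_sum, mem_multiIndices.1 α.2]
  rw [smul_smul, hm, ← Finset.prod_mul_distrib]
  simp [mul_pow]

omit [FiniteDimensional ℂ E] in
theorem fourier_partialDeriv (i : Fin N) (u : SchwartzMap (RN N) E) :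
    ∃ v : SchwartzMap (RN N) E, ⇑v = partialDeriv i u ∧
      ∀ ξ, 𝓕 v ξ = (2 * Real.pi * Complex.I * ξ i) • 𝓕 u ξ := by
  refine ⟨LineDeriv.lineDerivOp (EuclideanSpace.single i (1 : ℝ)) u, ?_, fun ξ => ?_⟩
  · ext x
    rw [SchwartzMap.lineDerivOp_apply, partialDeriv, u.differentiableAt.lineDeriv_eq_fderiv]
  · rw [SchwartzMap.fourier_lineDerivOp_eq, smul_apply,
      SchwartzMap.smulLeftCLM_apply_apply (by fun_prop), mul_smul _ (ξ i : ℂ), Complex.coe_smul]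
    simp [EuclideanSpace.inner_single_right]

omit [FiniteDimensional ℂ E] in
theorem fourier_partialDeriv_iterate (i : Fin N) (k : ℕ) (u : SchwartzMap (RN N) E) :
    ∃ v : SchwartzMap (RN N) E, ⇑v = (partialDeriv i)^[k] u ∧
      ∀ ξ, 𝓕 v ξ = (2 * Real.pi * Complex.I * ξ i) ^ k • 𝓕 u ξ := by
  induction k with
  | zero => exact ⟨u, rfl, fun ξ => by simp⟩
  | succ k ih =>
    obtain ⟨v, hv, hv'⟩ := ih
    obtain ⟨w, hw, hw'⟩ := fourier_partialDeriv i v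
    refine ⟨w, ?_, fun ξ => ?_⟩
    · rw [Function.iterate_succ_apply', ← hv, hw]
    · rw [hw', hv', smul_smul, pow_succ']

omit [FiniteDimensional ℂ E] in
theorem fourier_multiDeriv (α : Fin N → ℕ) (u : SchwartzMap (RN N) E) :
    ∃ v : SchwartzMap (RN N) E, ⇑v = multiDeriv α u ∧
      ∀ ξ, 𝓕 v ξ = (∏ i, (2 * Real.pi * Complex.I * ξ i) ^ α i) • 𝓕 u ξ := by
  have key : ∀ l : List (Fin N), ∃ v : SchwartzMap (RN N) E,
      ⇑v = l.foldr (fun i g => (partialDeriv i)^[α i] g) u ∧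
      ∀ ξ, 𝓕 v ξ = (l.map fun i => (2 * Real.pi * Complex.I * ξ i) ^ α i).prod • 𝓕 u ξ := by
    intro l
    induction l with
    | nil => exact ⟨u, rfl, fun ξ => by simp⟩
    | cons i l ih =>
      obtain ⟨v, hv, hv'⟩ := ih
      obtain ⟨w, hw, hw'⟩ := fourier_partialDeriv_iterate i (α i) v
      refine ⟨w, ?_, fun ξ => ?_⟩
      · rw [List.foldr_cons, ← hv, hw]
      · rw [hw', hv', smul_smul, List.map_cons, List.prod_cons]
  simpa only [Fin.prod_univ_def, multiDeriv] using key (List.finRange N)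

theorem fourier_apply [FiniteDimensional ℂ F] (u : SchwartzMap (RN N) E) :
    ∃ g : SchwartzMap (RN N) F, ⇑g = A.apply u ∧
      ∀ ξ, 𝓕 g ξ = (2 * Real.pi * Complex.I) ^ m • A.symbolCLM ξ (𝓕 u ξ) := by
  choose v hv hv' using fun α : multiIndices N m => fourier_multiDeriv α.1 u
  let a := fun α : multiIndices N m => LinearMap.toContinuousLinearMap (A.coeff α)
  refine ⟨∑ α, SchwartzMap.postcompCLM (𝕜 := ℂ) (a α) (v α), ?_, fun ξ => ?_⟩
  · ext x
    simp [apply, a, ← hv]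
  · have h1 : ∀ α, 𝓕 (SchwartzMap.postcompCLM (𝕜 := ℂ) (a α) (v α)) ξ = a α (𝓕 (v α) ξ) := by
      intro α
      rw [SchwartzMap.fourier_coe, SchwartzMap.fourier_coe, Real.fourier_eq, Real.fourier_eq,
        ← (a α).integral_comp_comm]
      · refine integral_congr_ae (ae_of_all _ fun y => ?_)
        simp only [SchwartzMap.postcompCLM_apply, Circle.smul_def]
        rw [map_smul]
      · exact (Real.fourierIntegral_convergent_iff ξ).2 (v α).integrable
    rw [FourierTransform.fourier_sum, sum_apply]
    simp_rw [h1, hv', symbolCLM_eq_sum, sum_apply, smul_apply, Finset.smul_sum]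
    refine Finset.sum_congr rfl fun α _ => ?_
    have hα : ∏ i, (2 * Real.pi * Complex.I * ξ i) ^ α.1 i
        = (2 * Real.pi * Complex.I) ^ m * ((∏ i, ξ i ^ α.1 i : ℝ) : ℂ) := by
      simp_rw [mul_pow _ (ξ _ : ℂ)]
      rw [Finset.prod_mul_distrib, Finset.prod_pow_eq_pow_sum, mem_multiIndices.1 α.2]
      push_cast
      rfl
    rw [hα, map_smul, mul_smul, Complex.coe_smul]

end HomDiffOp

end Symbol

/-! ### Multipliers as convolutions, and slicing in scale -/

section Multiplier

variable {V E F : Type*} [NormedAddCommGroup V] [InnerProductSpace ℝ V] [FiniteDimensional ℝ V]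
  [MeasurableSpace V] [BorelSpace V]
  [NormedAddCommGroup E] [NormedSpace ℂ E] [CompleteSpace E]
  [NormedAddCommGroup F] [NormedSpace ℂ F] [CompleteSpace F]

/-- This is the identity `∫ f̂ g = ∫ f ĝ` for `f(ξ) = e^{2πi x·ξ} η(tξ)`, whose transform is a
rescaled translate of the inverse transform of `η`. -/
theorem integral_dilated_multiplier (η : SchwartzMap V (F →L[ℂ] E)) {g : V → F} (hg : Integrable g)
    {t : ℝ} (ht : 0 < t) (x : V) :
    ∫ ξ, Real.fourierChar (inner ℝ ξ x) • η (t • ξ) (𝓕 g ξ)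
      = (t ^ Module.finrank ℝ V)⁻¹ • ∫ y, 𝓕⁻ η (t⁻¹ • (x - y)) (g y) := by
  let f : V → F →L[ℂ] E := fun ξ => Real.fourierChar (inner ℝ ξ x) • η (t • ξ)
  have hη : Integrable (fun ξ => η (t • ξ)) := η.integrable.comp_smul ht.ne'
  have hf : Integrable f := by
    have := (Real.fourierIntegral_convergent_iff (μ := volume) (-x)).2 hη
    simpa [f] using this
  have hft : ∀ y, 𝓕 f y = (t ^ Module.finrank ℝ V)⁻¹ • 𝓕⁻ η (t⁻¹ • (x - y)) := by
    intro y
    have h1 := Measure.integral_comp_smul volume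
      (fun ζ : V => Real.fourierChar (inner ℝ ζ (t⁻¹ • (x - y))) • η ζ) t
    rw [abs_of_pos (by positivity)] at h1
    rw [SchwartzMap.fourierInv_coe, Real.fourierInv_eq, ← h1, Real.fourier_eq]
    refine integral_congr_ae (ae_of_all _ fun ξ => ?_)
    simp only [f]
    rw [smul_smul, ← AddChar.map_add_eq_mul, inner_smul_left, inner_smul_right, inner_sub_right]
    congr 2
    simp
    field_simp
    ring
  have key := VectorFourier.integral_bilin_fourierIntegral_eq_flip (μ := (volume : Measure V))
    (ν := (volume : Measure V)) (L := innerₗ V) (ContinuousLinearMap.id ℂ (F →L[ℂ] E))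
    Real.continuous_fourierChar continuous_inner hf hg
  simp only [ContinuousLinearMap.id_apply, flip_innerₗ] at key
  have h2 : ∀ ξ, VectorFourier.fourierIntegral Real.fourierChar volume (innerₗ V) g ξ = 𝓕 g ξ :=
    fun ξ => rfl
  have h3 : ∀ ξ, VectorFourier.fourierIntegral Real.fourierChar volume (innerₗ V) f ξ = 𝓕 f ξ :=
    fun ξ => rfl
  simp only [h2, h3, hft] at key
  rw [← integral_smul]
  exact key.symm

theorem integral_fourier_annihilator (Ψ : SchwartzMap V (F →L[ℂ] F)) {g : V → F}
    (hg : Integrable g) {r : ℝ} (hr : 0 < r) (h : ∀ ξ, Ψ (r • ξ) (𝓕 g ξ) = 0) :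
    ∫ y, 𝓕 Ψ (r⁻¹ • y) (g y) = 0 := by
  have key := integral_dilated_multiplier Ψ hg hr 0
  simp only [h, smul_zero, integral_zero] at key
  have h1 := (smul_eq_zero.1 key.symm).resolve_left (by positivity)
  rw [← h1]
  refine integral_congr_ae (ae_of_all _ fun y => ?_)
  simp only [SchwartzMap.fourierInv_coe, SchwartzMap.fourier_coe, Real.fourierInv_eq_fourier_neg]
  simp

omit [CompleteSpace E] [CompleteSpace F] in
theorem integrable_schwartz_comp_apply (f : SchwartzMap V (F →L[ℂ] E)) {g : V → F}
    (hg : Integrable g) {φ : V → V} (hφ : Continuous φ) : Integrable fun y => f (φ y) (g y) := by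
  obtain ⟨C, hC, h⟩ := f.decay 0 0
  simp only [pow_zero, one_mul, norm_iteratedFDeriv_zero] at h
  refine (hg.norm.const_mul C).mono' ?_ (ae_of_all _ fun y => ?_)
  · exact (ContinuousLinearMap.apply ℂ E).flip.aestronglyMeasurable_comp₂
      (f.continuous.comp hφ).aestronglyMeasurable hg.aestronglyMeasurable
  · exact (ContinuousLinearMap.le_opNorm _ _).trans
      (mul_le_mul_of_nonneg_right (h _) (norm_nonneg _))

theorem integral_correctedKernel (k : SchwartzMap V (F →L[ℂ] E)) (Φ : SchwartzMap V (F →L[ℂ] F))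
    {g : V → F} (hg : Integrable g) (hΦ : ∀ r : ℝ, 0 < r → ∫ y, Φ (r⁻¹ • y) (g y) = 0)
    (x : V) (t : ℝ) :
    ∫ y, correctedKernel k Φ x y t (g y) = ∫ y, k (t⁻¹ • (x - y)) (g y) := by
  rcases eq_or_ne x 0 with rfl | hx
  · simp [correctedKernel]
  simp only [correctedKernel, if_neg hx, sub_apply, ContinuousLinearMap.comp_apply]
  rw [integral_sub (integrable_schwartz_comp_apply k hg (φ := fun y => t⁻¹ • (x - y)) (by fun_prop))
    ((k (t⁻¹ • x)).integrable_comp (integrable_schwartz_comp_apply Φ hg (φ := fun y => ‖x‖⁻¹ • y) (by fun_prop))),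
    (k (t⁻¹ • x)).integral_comp_comm (integrable_schwartz_comp_apply Φ hg (φ := fun y => ‖x‖⁻¹ • y) (by fun_prop)), hΦ _ (norm_pos_iff.2 hx), map_zero,
    sub_zero]

/-- Fubini applies because `χ ≥ 0`: the `t`-integral of the norm is exactly `‖G ξ‖` for `ξ ≠ 0`, and
the origin is null. -/
theorem integral_eq_integral_dilation [Nontrivial V] (χ : RadialCutoff V) {G : V → E} (hG : Integrable G) :
    ∫ ξ, G ξ = ∫ t in Set.Ioi (0 : ℝ), ∫ ξ, (t⁻¹ * χ (t • ξ)) • G ξ := by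
  have hne : ∀ᵐ ξ : V, ξ ≠ 0 := by
    simp [ae_iff]
  have hmeas : AEStronglyMeasurable (fun p : V × ℝ => (p.2⁻¹ * χ (p.2 • p.1)) • G p.1)
      (volume.prod (volume.restrict (Set.Ioi 0))) := by
    refine AEStronglyMeasurable.smul (𝕜 := ℝ) ?_ hG.aestronglyMeasurable.comp_fst
    refine (measurable_snd.inv.mul (χ.contDiff.continuous.measurable.comp ?_)).aestronglyMeasurable
    fun_prop
  have hint : Integrable (fun p : V × ℝ => (p.2⁻¹ * χ (p.2 • p.1)) • G p.1)
      (volume.prod (volume.restrict (Set.Ioi 0))) := by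
    rw [integrable_prod_iff hmeas]
    refine ⟨hne.mono fun ξ hξ => Integrable.smul_const (χ.integrableOn ξ hξ) (G ξ), hG.norm.congr ?_⟩
    filter_upwards [hne] with ξ hξ
    simp only [norm_smul]
    rw [integral_mul_const, setIntegral_congr_fun (g := fun t : ℝ => t⁻¹ * χ (t • ξ))
      measurableSet_Ioi fun t (ht : 0 < t) =>
        Real.norm_of_nonneg (mul_nonneg (inv_nonneg.2 ht.le) (χ.nonneg _)),
      χ.integral_eq_one ξ hξ, one_mul]
  rw [← integral_integral_swap hint]
  refine integral_congr_ae (hne.mono fun ξ hξ => ?_)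
  simp only
  rw [integral_smul_const, χ.integral_eq_one ξ hξ, one_smul]

end Multiplier

/-! ### Pointwise bound for the fractional Laplacian -/

section PointwiseBound

theorem enorm_integral_correctedKernel_le {V E F : Type*} [NormedAddCommGroup V]
    [InnerProductSpace ℝ V] [FiniteDimensional ℝ V] [Nontrivial V] [MeasurableSpace V]
    [BorelSpace V] [NormedAddCommGroup E] [NormedSpace ℂ E] [NormedAddCommGroup F]
    [NormedSpace ℂ F] {k : SchwartzMap V (F →L[ℂ] E)} {Φ : SchwartzMap V (F →L[ℂ] F)} {a : ℝ}
    {C : ℝ≥0}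
    (hC : ∀ x y : V, y ≠ 0 → x ≠ y →
      ∫⁻ t in Set.Ioi 0, ‖t ^ (-a - 1) • correctedKernel k Φ x y t‖ₑ
        ≤ C * (farKernel a x y + nearKernel a x y))
    {g : V → F} (hg : Continuous g) (x : V) :
    ‖∫ t in Set.Ioi (0 : ℝ), t ^ (-a - 1) • ∫ y, correctedKernel k Φ x y t (g y)‖ₑ
      ≤ C * ∫⁻ y, (farKernel a x y + nearKernel a x y) * ‖g y‖ₑ := by
  classical
  have hmeas : Measurable fun p : ℝ × V =>
      ‖p.1 ^ (-a - 1) • correctedKernel k Φ x p.2 p.1‖ₑ * ‖g p.2‖ₑ := by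
    refine Measurable.mul ?_ (hg.enorm.measurable.comp measurable_snd)
    -- In the variable `t⁻¹` the kernel is jointly continuous; measurable inversion then gives
    -- measurability in `t`.
    have h1 : Continuous fun p : ℝ × V => k (p.1 • (x - p.2))
        - (if x = 0 then 0 else k (p.1 • x)) ∘L Φ (‖x‖⁻¹ • p.2) := by
      have hk := k.continuous
      have hΦ := Φ.continuous
      refine Continuous.sub (by fun_prop) (Continuous.clm_comp ?_ (by fun_prop))
      split_ifs <;> fun_prop
    have h2 : Measurable fun p : ℝ × V => ‖correctedKernel k Φ x p.2 p.1‖ₑ := by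
      have := h1.enorm.measurable.comp
        (show Measurable fun p : ℝ × V => (p.1⁻¹, p.2) by fun_prop)
      convert! this using 4
    have h3 : Measurable fun p : ℝ × V => ‖p.1 ^ (-a - 1)‖ₑ := by fun_prop
    simp only [enorm_smul]
    exact h3.mul h2
  have hne : ∀ᵐ y : V, y ≠ 0 ∧ x ≠ y := by
    have h : ∀ z : V, ∀ᵐ y : V, y ≠ z := fun z => by simp [ae_iff]
    filter_upwards [h 0, h x] with y h0 h1 using ⟨h0, h1.symm⟩
  calc ‖∫ t in Set.Ioi (0 : ℝ), t ^ (-a - 1) • ∫ y, correctedKernel k Φ x y t (g y)‖ₑ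
      ≤ ∫⁻ t in Set.Ioi (0 : ℝ), ‖t ^ (-a - 1) • ∫ y, correctedKernel k Φ x y t (g y)‖ₑ :=
        enorm_integral_le_lintegral_enorm _
    _ ≤ ∫⁻ t in Set.Ioi (0 : ℝ), ∫⁻ y, ‖t ^ (-a - 1) • correctedKernel k Φ x y t‖ₑ * ‖g y‖ₑ := by
        refine lintegral_mono fun t => ?_
        rw [← integral_smul]
        refine (enorm_integral_le_lintegral_enorm _).trans (lintegral_mono fun y => ?_)
        exact ContinuousLinearMap.le_opENorm (t ^ (-a - 1) • correctedKernel k Φ x y t) (g y)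
    _ = ∫⁻ y, ∫⁻ t in Set.Ioi (0 : ℝ), ‖t ^ (-a - 1) • correctedKernel k Φ x y t‖ₑ * ‖g y‖ₑ :=
        lintegral_lintegral_swap hmeas.aemeasurable
    _ ≤ ∫⁻ y, C * ((farKernel a x y + nearKernel a x y) * ‖g y‖ₑ) := by
        refine lintegral_mono_ae (hne.mono fun y hy => ?_)
        rw [lintegral_mul_const' _ _ enorm_ne_top, ← mul_assoc]
        gcongr
        exact hC x y hy.1 hy.2
    _ = _ := lintegral_const_mul' _ _ ENNReal.coe_ne_top

theorem integrable_rpow_norm_smul {V E : Type*} [NormedAddCommGroup V]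
    [InnerProductSpace ℝ V] [FiniteDimensional ℝ V] [MeasurableSpace V]
    [BorelSpace V] [NormedAddCommGroup E] [NormedSpace ℂ E] (v : SchwartzMap V E) {s : ℝ}
    (hs : 0 ≤ s) : Integrable fun ξ : V => (2 * Real.pi * ‖ξ‖) ^ s • v ξ := by
  obtain ⟨n, hn⟩ := exists_nat_ge s
  have h1 : Integrable fun ξ : V => (2 * Real.pi) ^ s * (‖ξ‖ ^ 0 * ‖v ξ‖ + ‖ξ‖ ^ n * ‖v ξ‖) :=
    ((v.integrable_pow_mul volume 0).add (v.integrable_pow_mul volume n)).const_mul _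
  refine h1.mono' ?_ (ae_of_all _ fun ξ => ?_)
  · have h2 : Continuous fun ξ : V => (2 * Real.pi * ‖ξ‖) ^ s :=
      (show Continuous fun ξ : V => 2 * Real.pi * ‖ξ‖ by fun_prop).rpow_const fun _ => Or.inr hs
    exact (h2.smul v.continuous).aestronglyMeasurable
  · rw [norm_smul, Real.norm_of_nonneg (by positivity), Real.mul_rpow (by positivity) (by positivity),
      mul_assoc, ← add_mul, pow_zero]
    gcongr
    rcases le_total ‖ξ‖ 1 with h | h
    · exact (Real.rpow_le_one (norm_nonneg _) h hs).trans (le_add_of_nonneg_right (by positivity))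
    · rw [← Real.rpow_natCast]
      exact (Real.rpow_le_rpow_of_exponent_le h hn).trans (le_add_of_nonneg_left zero_le_one)

variable {N m : ℕ} {E F : Type*}
  [NormedAddCommGroup E] [NormedSpace ℂ E] [FiniteDimensional ℂ E]
  [NormedAddCommGroup F] [NormedSpace ℂ F] [FiniteDimensional ℂ F]

/-- The multiplier of homogeneity `-ℓ` which maps `A(D)u` to the fractional Laplacian of `u`. -/
noncomputable def fracMultiplier (m : ℕ) (ℓ : ℝ) (B : RN N → F →L[ℂ] E) (ξ : RN N) : F →L[ℂ] E :=
  (2 * Real.pi * ‖ξ‖) ^ ((m : ℝ) - ℓ) • (((2 * Real.pi * Complex.I) ^ m)⁻¹ : ℂ) • B ξ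

omit [FiniteDimensional ℂ E] [FiniteDimensional ℂ F] in
theorem contDiffOn_fracMultiplier (ℓ : ℝ) {B : RN N → F →L[ℂ] E} (hB : ContDiffOn ℝ ∞ B {0}ᶜ) :
    ContDiffOn ℝ ∞ (fracMultiplier m ℓ B) {0}ᶜ := by
  intro ξ hξ
  have hξ0 : 0 < ‖ξ‖ := norm_pos_iff.2 hξ
  refine ContDiffWithinAt.smul (𝕜 := ℝ) (𝕜' := ℝ) ?_
    ((hB ξ hξ).const_smul (((2 * Real.pi * Complex.I) ^ m)⁻¹ : ℂ))
  refine ContDiffAt.contDiffWithinAt ?_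
  refine ContDiffAt.rpow_const_of_ne (contDiffAt_const.mul (contDiffAt_norm ℝ hξ)) ?_
  positivity

omit [FiniteDimensional ℂ F] in
-- The powers of `t` are `t^{ℓ-1} t^{m-ℓ} t^{-m} = t⁻¹`, leaving the weight of the partition of
-- unity.
theorem fracMultiplier_dilate (χ : RadialCutoff (RN N)) {A : HomDiffOp N m E F} {ℓ : ℝ}
    {B : RN N → F →L[ℂ] E}
    (hBA : ∀ ξ, ξ ≠ 0 → B ξ ∘L A.symbolCLM ξ = ContinuousLinearMap.id ℂ E)
    (hBhom : ∀ (t : ℝ) (ξ : RN N), 0 < t → ξ ≠ 0 → B (t • ξ) = (t ^ m)⁻¹ • B ξ) {t : ℝ}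
    (ht : 0 < t) (ξ : RN N) (e : E) :
    t ^ (ℓ - 1) • (χ (t • ξ) • fracMultiplier m ℓ B (t • ξ))
        ((2 * Real.pi * Complex.I) ^ m • A.symbolCLM ξ e)
      = (t⁻¹ * χ (t • ξ)) • (2 * Real.pi * ‖ξ‖) ^ ((m : ℝ) - ℓ) • e := by
  rcases eq_or_ne ξ 0 with rfl | hξ
  · simp [χ.zero_eq_zero]
  have h1 : B ξ (A.symbolCLM ξ e) = e := congrArg (fun S => S e) (hBA ξ hξ)
  have h2 : ((2 * Real.pi * Complex.I) ^ m : ℂ) ≠ 0 :=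
    pow_ne_zero _ (by simp [Real.pi_ne_zero])
  rw [fracMultiplier, hBhom t ξ ht hξ, map_smul]
  simp only [smul_apply, h1]
  rw [smul_comm (((2 * Real.pi * Complex.I) ^ m : ℂ)) (χ (t • ξ)),
    smul_comm (((2 * Real.pi * Complex.I) ^ m : ℂ)) ((2 * Real.pi * ‖t • ξ‖) ^ ((m : ℝ) - ℓ)),
    smul_smul (((2 * Real.pi * Complex.I) ^ m : ℂ)), mul_inv_cancel₀ h2, one_smul, smul_smul,
    smul_smul, smul_smul, smul_smul]
  congr 1
  have h3 : t ^ (ℓ - 1) * (t ^ ((m : ℝ) - ℓ) * (t ^ m)⁻¹) = t⁻¹ := by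
    rw [← Real.rpow_natCast, ← Real.rpow_neg ht.le, ← Real.rpow_add ht, ← Real.rpow_add ht,
      ← Real.rpow_neg_one]
    congr 1
    ring
  rw [norm_smul, Real.norm_of_nonneg ht.le, mul_left_comm _ t,
    Real.mul_rpow ht.le (by positivity), ← h3]
  ring

theorem exists_fracLaplacian_enorm_le [Nonempty (Fin N)] (A : HomDiffOp N m E F)
    (hell : A.IsElliptic) (hcan : A.IsCanceling) {ℓ : ℝ} (hℓN : ℓ < N) (hℓm : ℓ ≤ m) :
    ∃ C : ℝ≥0, ∀ u : RN N → E, ContDiff ℝ ∞ u → HasCompactSupport u → ∀ x,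
      ‖fracLaplacian ((m : ℝ) - ℓ) u x‖ₑ
        ≤ C * ∫⁻ y, (farKernel (N - ℓ) x y + nearKernel (N - ℓ) x y) * ‖A.apply u y‖ₑ := by
  obtain ⟨χ⟩ := nonempty_radialCutoff (RN N)
  obtain ⟨B, hBs, hBA, hBhom, -⟩ := exists_leftInverse A.contDiff_symbolCLM hell A.symbolCLM_smul
  obtain ⟨Ψ, hΨs, hΨc, hΨA, hΨ⟩ := exists_annihilator_integral_eq_id (μ := volume) χ
    A.contDiff_symbolCLM hell A.symbolCLM_smul fun f hf => by
      have : f ∈ ⋂ ξ ∈ {ξ : RN N | ξ ≠ 0}, Set.range (A.symbol ξ) := Set.mem_iInter₂.2 hf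
      rwa [hcan] at this
  let Ψs := hΨc.toSchwartzMap hΨs
  let η := (χ.hasCompactSupport_smul (fracMultiplier m ℓ B)).toSchwartzMap
    (χ.contDiff_smul (contDiffOn_fracMultiplier ℓ hBs))
  let k : SchwartzMap (RN N) (F →L[ℂ] E) := 𝓕⁻ η
  let Φ : SchwartzMap (RN N) (F →L[ℂ] F) := 𝓕 Ψs
  have hΦ0 : Φ 0 = ContinuousLinearMap.id ℂ F := by
    rw [SchwartzMap.fourier_coe, Real.fourier_eq, ← hΨ]
    simp [Ψs]
  have ha : 0 < (N : ℝ) - ℓ := by linarith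
  obtain ⟨C, hC⟩ := exists_lintegral_correctedKernel_le k Φ hΦ0 ha
  refine ⟨C, fun u hu huc x => ?_⟩
  obtain ⟨g, hg, hgF⟩ := A.fourier_apply (huc.toSchwartzMap hu)
  have hgF' : ∀ ξ, 𝓕 (g : RN N → F) ξ
      = (2 * Real.pi * Complex.I) ^ m • A.symbolCLM ξ (𝓕 u ξ) := fun ξ => by
    have := hgF ξ
    rwa [SchwartzMap.fourier_coe, SchwartzMap.fourier_coe] at this
  -- The vectors `A(ξ)e` and `A(rξ)e` are proportional, so `Ψ(rξ)` annihilates the transform of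
  -- `A(D)u` at `ξ`.
  have hcancel : ∀ r : ℝ, 0 < r → ∫ y, Φ (r⁻¹ • y) (g y) = 0 := fun r hr => by
    refine integral_fourier_annihilator Ψs g.integrable hr fun ξ => ?_
    have h1 : A.symbolCLM ξ (𝓕 u ξ) = (r ^ m)⁻¹ • A.symbolCLM (r • ξ) (𝓕 u ξ) := by
      rw [A.symbolCLM_smul, smul_apply, smul_smul, inv_mul_cancel₀ (by positivity), one_smul]
    rw [hgF', h1, map_smul, ContinuousLinearMap.map_smul_of_tower]
    change _ • _ • Ψ (r • ξ) _ = 0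
    rw [hΨA, smul_zero, smul_zero]
  let G : RN N → E := fun ξ =>
    Real.fourierChar (inner ℝ ξ x) • (2 * Real.pi * ‖ξ‖) ^ ((m : ℝ) - ℓ) • 𝓕 u ξ
  have hG : Integrable G := by
    have h1 := integrable_rpow_norm_smul (𝓕 (huc.toSchwartzMap hu)) (sub_nonneg.2 hℓm)
    have h2 := (Real.fourierIntegral_convergent_iff (μ := volume) (-x)).2 h1
    simp only [inner_neg_right, neg_neg] at h2
    exact h2
  -- The exponent combines `t^{ℓ-1}` from the sliced multiplier with the Jacobian `t^{-N}`.
  have hrep : fracLaplacian ((m : ℝ) - ℓ) u x = ∫ t in Set.Ioi (0 : ℝ),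
      t ^ (-((N : ℝ) - ℓ) - 1) • ∫ y, correctedKernel k Φ x y t (g y) := by
    rw [fracLaplacian, Real.fourierInv_eq]
    simp only [Complex.coe_smul]
    rw [integral_eq_integral_dilation χ hG]
    refine setIntegral_congr_fun measurableSet_Ioi fun t (ht : 0 < t) => ?_
    have h1 := integral_dilated_multiplier η (g.integrable (μ := volume)) ht x
    have h2 : ∀ ξ, (t⁻¹ * χ (t • ξ)) • G ξ
        = t ^ (ℓ - 1) • Real.fourierChar (inner ℝ ξ x) • η (t • ξ) (𝓕 (g : RN N → F) ξ) := by
      intro ξ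
      rw [hgF', smul_comm (t ^ (ℓ - 1))]
      change _ = _ • t ^ (ℓ - 1) • (χ (t • ξ) • fracMultiplier m ℓ B (t • ξ)) _
      rw [fracMultiplier_dilate χ hBA hBhom ht, smul_comm]
    simp only [h2]
    rw [integral_smul, h1, integral_correctedKernel k Φ g.integrable hcancel, smul_smul]
    congr 1
    rw [finrank_euclideanSpace_fin, ← Real.rpow_natCast, ← Real.rpow_neg ht.le, ← Real.rpow_add ht]
    congr 1
    ring
  rw [hrep]
  refine (enorm_integral_correctedKernel_le hC g.continuous x).trans (le_of_eq ?_)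
  rw [hg]
  rfl

end PointwiseBound

/-! ### Testing conditions and the weighted estimate -/

section Weighted

variable {N : ℕ}

theorem measurable_farKernel (a : ℝ) :
    Measurable fun p : RN N × RN N => farKernel a p.1 p.2 := by
  refine Measurable.mul (by fun_prop) ?_
  have hs : MeasurableSet {p : RN N × RN N | p.1 ∈ (Metric.ball (0 : RN N) (2 * ‖p.2‖))ᶜ} := by
    simp only [Set.mem_compl_iff, mem_ball_zero_iff, not_lt]
    exact measurableSet_le (by fun_prop) (by fun_prop)
  exact Measurable.indicator (f := fun p : RN N × RN N => ‖p.1‖ₑ ^ (-(a + 1))) (by fun_prop) hs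

theorem measurable_nearKernel (a : ℝ) :
    Measurable fun p : RN N × RN N => nearKernel a p.1 p.2 := by
  have hs : MeasurableSet {p : RN N × RN N | p.1 ∈ Metric.ball (0 : RN N) (4 * ‖p.2‖)} := by
    simp only [mem_ball_zero_iff]
    exact measurableSet_lt (by fun_prop) (by fun_prop)
  exact Measurable.indicator (f := fun p : RN N × RN N => ‖p.1 - p.2‖ₑ ^ (-a)) (by fun_prop) hs

theorem lintegral_farKernel_rpow {q : ℝ} (hq : 0 < q) (ν : Measure (RN N)) (a : ℝ) (y : RN N) :
    (∫⁻ x, farKernel a x y ^ q ∂ν) ^ (1 / q)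
      = ‖y‖ₑ * (∫⁻ x in (Metric.ball (0 : RN N) (2 * ‖y‖))ᶜ, ‖x‖ₑ ^ (-((a + 1) * q)) ∂ν)
        ^ (1 / q) := by
  rw [← lintegral_indicator Metric.isOpen_ball.measurableSet.compl]
  simp only [farKernel, ENNReal.mul_rpow_of_nonneg _ _ hq.le]
  rw [lintegral_const_mul' _ _ (ENNReal.rpow_ne_top_of_nonneg hq.le enorm_ne_top),
    ENNReal.mul_rpow_of_nonneg _ _ (by positivity), ← ENNReal.rpow_mul, mul_one_div_cancel hq.ne',
    ENNReal.rpow_one]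
  congr 3 with x
  by_cases hx : x ∈ (Metric.ball (0 : RN N) (2 * ‖y‖))ᶜ
  · rw [Set.indicator_of_mem hx, Set.indicator_of_mem hx, ← ENNReal.rpow_mul, neg_mul]
  · rw [Set.indicator_of_notMem hx, Set.indicator_of_notMem hx, ENNReal.zero_rpow_of_pos hq]

theorem lintegral_nearKernel_rpow {q : ℝ} (hq : 0 < q) (ν : Measure (RN N)) (a : ℝ) (y : RN N) :
    (∫⁻ x, nearKernel a x y ^ q ∂ν) ^ (1 / q)
      = (∫⁻ x in Metric.ball (0 : RN N) (4 * ‖y‖), ‖x - y‖ₑ ^ (-(a * q)) ∂ν) ^ (1 / q) := by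
  rw [← lintegral_indicator Metric.isOpen_ball.measurableSet]
  congr 2 with x
  simp only [nearKernel]
  by_cases hx : x ∈ Metric.ball (0 : RN N) (4 * ‖y‖)
  · rw [Set.indicator_of_mem hx, Set.indicator_of_mem hx, ← ENNReal.rpow_mul, neg_mul]
  · rw [Set.indicator_of_notMem hx, Set.indicator_of_notMem hx, ENNReal.zero_rpow_of_pos hq]

/-- The testing conditions bound the `L^q(ν)` norms in `x` of the two kernels; the factor `|y|` of
the far kernel cancels the `1/|y|` in its condition. -/
theorem exists_kernel_testing [Nonempty (Fin N)] {ℓ q : ℝ} (hq : 1 ≤ q) {ν : Measure (RN N)}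
    {w : RN N → ℝ} (hfar : TestingFar ℓ q ν w) (hnear : TestingNear ℓ q ν w) :
    ∃ C : ℝ≥0, ∀ᵐ y : RN N,
      (∫⁻ x, (farKernel (N - ℓ) x y + nearKernel (N - ℓ) x y) ^ q ∂ν) ^ (1 / q)
        ≤ C * ENNReal.ofReal (w y) := by
  obtain ⟨C1, h1⟩ := hfar
  obtain ⟨C2, h2⟩ := hnear
  have hq0 : 0 < q := by linarith
  have hne : ∀ᵐ y : RN N, y ≠ 0 := by simp [ae_iff]
  refine ⟨C1 + C2, ?_⟩
  filter_upwards [h1, h2, hne] with y h1 h2 hy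
  have hy0 : 0 < ‖y‖ := norm_pos_iff.2 hy
  refine (ENNReal.lintegral_Lp_add_le
    ((measurable_farKernel _).comp measurable_prodMk_right).aemeasurable
    ((measurable_nearKernel _).comp measurable_prodMk_right).aemeasurable hq).trans ?_
  simp only [Function.comp_apply]
  rw [lintegral_farKernel_rpow hq0, lintegral_nearKernel_rpow hq0, ENNReal.coe_add, add_mul (C1 : ℝ≥0∞)]
  refine add_le_add ?_ h2
  refine (mul_le_mul_right h1 _).trans (le_of_eq ?_)
  rw [mul_left_comm, ENNReal.ofReal_div_of_pos hy0, ofReal_norm,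
    ENNReal.mul_div_cancel (enorm_ne_zero.2 hy) enorm_ne_top]

theorem weighted_estimate_of_pointwise [Nonempty (Fin N)] {F : Type*} [NormedAddCommGroup F]
    {ℓ q : ℝ} (hq : 1 ≤ q) {ν : Measure (RN N)} [SigmaFinite ν] {w : RN N → ℝ}
    {C : ℝ≥0} (hC : ∀ᵐ y : RN N,
      (∫⁻ x, (farKernel (N - ℓ) x y + nearKernel (N - ℓ) x y) ^ q ∂ν) ^ (1 / q)
        ≤ C * ENNReal.ofReal (w y))
    {D : ℝ≥0} {f : RN N → ℝ≥0∞} {g : RN N → F} (hg : Continuous g)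
    (hf : ∀ x, f x ≤ D * ∫⁻ y, (farKernel (N - ℓ) x y + nearKernel (N - ℓ) x y) * ‖g y‖ₑ) :
    (∫⁻ x, f x ^ q ∂ν) ^ (1 / q) ≤ D * C * ∫⁻ y, ‖g y‖ₑ * ENNReal.ofReal (w y) := by
  have hq0 : 0 < q := by linarith
  have hgm : Measurable fun y => ‖g y‖ₑ := hg.enorm.measurable
  have hm : Measurable (Function.uncurry fun x y : RN N =>
      (farKernel (N - ℓ) x y + nearKernel (N - ℓ) x y) * ‖g y‖ₑ) :=
    ((measurable_farKernel _).add (measurable_nearKernel _)).mul (hgm.comp measurable_snd)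
  calc (∫⁻ x, f x ^ q ∂ν) ^ (1 / q)
      ≤ (∫⁻ x, (D : ℝ≥0∞) ^ q * (∫⁻ y, (farKernel (N - ℓ) x y + nearKernel (N - ℓ) x y)
          * ‖g y‖ₑ) ^ q ∂ν) ^ (1 / q) := by
        gcongr with x
        rw [← ENNReal.mul_rpow_of_nonneg _ _ hq0.le]
        gcongr
        exact hf x
    _ = D * (∫⁻ x, (∫⁻ y, (farKernel (N - ℓ) x y + nearKernel (N - ℓ) x y)
          * ‖g y‖ₑ) ^ q ∂ν) ^ (1 / q) := by
        rw [lintegral_const_mul' _ _ (ENNReal.rpow_ne_top_of_nonneg hq0.le ENNReal.coe_ne_top),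
          ENNReal.mul_rpow_of_nonneg _ _ (by positivity), ← ENNReal.rpow_mul,
          mul_one_div_cancel hq0.ne', ENNReal.rpow_one]
    _ ≤ D * ∫⁻ y, (∫⁻ x, ((farKernel (N - ℓ) x y + nearKernel (N - ℓ) x y)
          * ‖g y‖ₑ) ^ q ∂ν) ^ (1 / q) := by
        gcongr
        exact lintegral_rpow_lintegral_le hq hm
    _ ≤ D * ∫⁻ y, C * (‖g y‖ₑ * ENNReal.ofReal (w y)) := by
        gcongr 1
        refine lintegral_mono_ae (hC.mono fun y hy => ?_)
        simp only [ENNReal.mul_rpow_of_nonneg _ _ hq0.le]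
        rw [lintegral_mul_const' _ _ (ENNReal.rpow_ne_top_of_nonneg hq0.le enorm_ne_top),
          ENNReal.mul_rpow_of_nonneg _ _ (by positivity), ← ENNReal.rpow_mul,
          mul_one_div_cancel hq0.ne', ENNReal.rpow_one, mul_left_comm, mul_comm]
        gcongr
    _ = _ := by
        rw [lintegral_const_mul' _ _ ENNReal.coe_ne_top, mul_assoc]

end Weighted

end WeightedHLS

theorem theorem6p5
    {N m : ℕ} (hN : 2 ≤ N)
    {E F : Type*}
    [NormedAddCommGroup E] [NormedSpace ℂ E] [FiniteDimensional ℂ E]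
    [NormedAddCommGroup F] [NormedSpace ℂ F] [FiniteDimensional ℂ F]
    (A : WeightedHLS.HomDiffOp N m E F) (hell : A.IsElliptic) (hcan : A.IsCanceling)
    (q : ℝ) (hq : 1 ≤ q)
    (ℓ : ℝ) (hℓ0 : 0 < ℓ) (hℓN : ℓ < (N : ℝ)) (hℓm : ℓ ≤ (m : ℝ))
    (ν : Measure (WeightedHLS.RN N)) [SigmaFinite ν]
    (w : WeightedHLS.RN N → ℝ) (hw : WeightedHLS.IsWeight w)
    (hfar : WeightedHLS.TestingFar ℓ q ν w) (hnear : WeightedHLS.TestingNear ℓ q ν w) :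
    ∃ C : ℝ≥0, 0 < C ∧
      ∀ u : WeightedHLS.RN N → E, ContDiff ℝ ((⊤ : ℕ∞) : WithTop ℕ∞) u → HasCompactSupport u →
        (∫⁻ x, ‖WeightedHLS.fracLaplacian ((m : ℝ) - ℓ) u x‖ₑ ^ q ∂ν) ^ (1 / q)
          ≤ C * WeightedHLS.weightedL1Norm w (A.apply u) := by
  have : Nonempty (Fin N) := ⟨⟨0, by omega⟩⟩
  obtain ⟨D, hD⟩ := WeightedHLS.exists_fracLaplacian_enorm_le A hell hcan hℓN hℓm
  obtain ⟨C, hC⟩ := WeightedHLS.exists_kernel_testing hq hfar hnear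
  -- The added `1` only ensures that the constant is positive.
  refine ⟨D * C + 1, by positivity, fun u hu huc => ?_⟩
  obtain ⟨g, hg, -⟩ := A.fourier_apply (huc.toSchwartzMap hu)
  have hcont : Continuous (A.apply u) := by
    have := g.continuous
    rwa [hg] at this
  refine (WeightedHLS.weighted_estimate_of_pointwise hq hC hcont (hD u hu huc)).trans ?_
  rw [WeightedHLS.weightedL1Norm, ENNReal.coe_add, ENNReal.coe_mul]
  gcongr
  exact le_self_add
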